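/- Let $1\in A\subset B$ be an inclusion of unital C*-algebras, and let $E\colon B\to A$ be a faithful conditional expectation (a faithful positive $A$-bimodule map of norm at most one which is the identity on $A$). Suppose that $E$ has index-finite type, that is, there are $u_1,\dots,u_m\in B$ with $b=\sum_j u_jE(u_j^*b)=\sum_j E(bu_j)u_j^*$ for all $b\in B$, and let $\mathrm{Index}(E)=\sum_j u_ju_j^*$, a positive invertible central element of $B$ independent of the choice of the $u_j$. The basic construction for such an $E$ is the C*-algebra $C^*(B,e)$ of adjointable operators on the Hilbert $A$-module $B$ with inner product $\langle x,y\rangle=E(x^*y)$ which is generated by $B$, acting by left multiplication, and the Jones projection $e(x)=E(x)$. The dual conditional expectation $C^*(B,e)\to B$ is the one determined by $xey\mapsto \mathrm{Index}(E)^{-1}xy$ for $x,y\in B$; it is again faithful and of index-finite type. Set $B_0=A$, $B_1=B$, $E_1=E$ and, for $k\ge 1$, let $B_{k+1}=C^*(B_k,e_k)$ be the basic construction for $E_k\colon B_k\to B_{k-1}$, and let $E_{k+1}\colon B_{k+1}\to B_k$ be the dual conditional expectation of $E_k$. If $\mathrm{Index}(E)\in A$, then for every $n\ge 1$ the algebra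 $B_{2n}$ is the basic construction for $A\subset B_n$ and the conditional expectation $F=E_1\circ E_2\circ\cdots\circ E_n\colon B_n\to A$: there is a *-isomorphism from $C^*(B_n,e_F)$ onto $B_{2n}$ which restricts to the identity on $B_n$. -/

import Mathlib

universe u

namespace CStarIndex

open scoped CStarAlgebra

section Expectation

variable {A B : Type u} [CStarAlgebra A] [CStarAlgebra B]

theorem map_star_of_positive (G : B →ₗ[ℂ] A)
    (hG : ∀ b : B, ∃ a : A, G (star b * b) = star a * a) (b : B) : G (star b) = star (G b) := by
  have key : ∀ c : B, IsSelfAdjoint (G (star c * c)) := fun c => by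
    obtain ⟨a, ha⟩ := hG c
    rw [ha]
    exact IsSelfAdjoint.star_mul_self a
  have sa : ∀ c : B, IsSelfAdjoint c → IsSelfAdjoint (G c) := fun c hc => by
    have h1 : star (1 + c) * (1 + c) = 1 + (c + c) + star c * c := by
      simp only [star_add, star_one, hc.star_eq]; noncomm_ring
    have h2 : G c = (1 / 2 : ℝ) • (G (star (1 + c) * (1 + c)) - G (star (1 : B) * 1)
        - G (star c * c)) := by
      rw [h1]
      simp only [map_add, star_one, mul_one, ← two_smul ℝ (G c)]
      have : G 1 + (2 : ℝ) • G c + G (star c * c) - G 1 - G (star c * c) = (2 : ℝ) • G c := by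
        abel
      rw [this, smul_smul]; norm_num
    rw [h2]
    exact (IsSelfAdjoint.all (1 / 2 : ℝ)).smul (((key _).sub (key _)).sub (key _))
  conv_lhs => rw [← realPart_add_I_smul_imaginaryPart b]
  conv_rhs => rw [← realPart_add_I_smul_imaginaryPart b]
  have hr := (sa _ (realPart b).2).star_eq
  have hi := (sa _ (imaginaryPart b).2).star_eq
  simp only [star_add, map_add, star_smul, map_smul, hr, hi, (realPart b).2.star_eq,
    (imaginaryPart b).2.star_eq]

/-- A faithful conditional expectation `E : B → A` for a unital inclusion `ι : A → B` of unital
C⋆-algebras: a faithful positive `A`-bimodule map of norm at most one which is the identity on `A`.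
Positivity says that each `E (b⋆ b)` is of the form `a⋆ a`. (The unital ⋆-homomorphism `ι` is
injective as soon as such an `E` exists, see `FaithfulCondExp.injective`.) -/
structure FaithfulCondExp (ι : A →⋆ₐ[ℂ] B) extends B →ₗ[ℂ] A where
  map_incl : ∀ a : A, toFun (ι a) = a
  map_incl_mul : ∀ (a : A) (b : B), toFun (ι a * b) = a * toFun b
  map_mul_incl : ∀ (b : B) (a : A), toFun (b * ι a) = toFun b * a
  positive : ∀ b : B, ∃ a : A, toFun (star b * b) = star a * a
  norm_le : ∀ b : B, ‖toFun b‖ ≤ ‖b‖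
  faithful : ∀ b : B, toFun (star b * b) = 0 → b = 0

namespace FaithfulCondExp

variable {ι : A →⋆ₐ[ℂ] B}

instance : FunLike (FaithfulCondExp ι) B A where
  coe E := E.toFun
  coe_injective E F h := by
    cases E; cases F
    congr
    exact LinearMap.ext fun x => congrFun h x

instance : LinearMapClass (FaithfulCondExp ι) ℂ B A where
  map_add E := E.toLinearMap.map_add
  map_smulₛₗ E := E.toLinearMap.map_smul

variable (E : FaithfulCondExp ι)

theorem apply_incl (a : A) : E (ι a) = a := E.map_incl a

theorem apply_incl_mul (a : A) (b : B) : E (ι a * b) = a * E b := E.map_incl_mul a b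

theorem apply_mul_incl (b : B) (a : A) : E (b * ι a) = E b * a := E.map_mul_incl b a

theorem injective (E : FaithfulCondExp ι) : Function.Injective ι := Function.LeftInverse.injective E.apply_incl

theorem apply_star (b : B) : E (star b) = star (E b) :=
  map_star_of_positive E.toLinearMap E.positive b

/-- `((u₁, u₁⋆), …, (uₙ, uₙ⋆))` is a quasi-basis for `E`. -/
structure IsQuasiBasis {n : ℕ} (u : Fin n → B) : Prop where
  left : ∀ b : B, ∑ j, u j * ι (E (star (u j) * b)) = b
  right : ∀ b : B, ∑ j, ι (E (b * u j)) * star (u j) = b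

theorem IsQuasiBasis.of_left {n : ℕ} {u : Fin n → B}
    (h : ∀ b : B, ∑ j, u j * ι (E (star (u j) * b)) = b) : E.IsQuasiBasis u where
  left := h
  right b := by
    have := congrArg star (h (star b))
    simpa [star_sum, ← map_star, ← apply_star] using this

/-- `E` has index-finite type: it has a quasi-basis. -/
class IsIndexFinite : Prop where
  exists_quasiBasis : ∃ (n : ℕ) (u : Fin n → B), E.IsQuasiBasis u

section Index

variable [hE : E.IsIndexFinite]

noncomputable def qbCard : ℕ := hE.exists_quasiBasis.choose

/-- A chosen quasi-basis. -/
noncomputable def qb : Fin E.qbCard → B := hE.exists_quasiBasis.choose_spec.choose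

theorem isQuasiBasis_qb : E.IsQuasiBasis E.qb := hE.exists_quasiBasis.choose_spec.choose_spec

/-- The index `∑ uⱼ uⱼ⋆` of `E`; see `index_eq` for the independence of the quasi-basis. -/
noncomputable def index : B := ∑ j, E.qb j * star (E.qb j)

theorem qb_left (b : B) : ∑ j, E.qb j * ι (E (star (E.qb j) * b)) = b :=
  E.isQuasiBasis_qb.left b

theorem qb_right (b : B) : ∑ j, ι (E (b * E.qb j)) * star (E.qb j) = b :=
  E.isQuasiBasis_qb.right b

theorem index_eq {n : ℕ} {v : Fin n → B} (hv : E.IsQuasiBasis v) :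
    E.index = ∑ j, v j * star (v j) := by
  calc E.index = ∑ k, ∑ j, v j * ι (E (star (v j) * E.qb k)) * star (E.qb k) := by
        refine Finset.sum_congr rfl fun k _ => ?_
        rw [← Finset.sum_mul, hv.left]
    _ = ∑ j, v j * star (v j) := by
        rw [Finset.sum_comm]
        refine Finset.sum_congr rfl fun j _ => ?_
        simp only [mul_assoc]
        rw [← Finset.mul_sum, E.qb_right]

/-- `T = ∑ T(uⱼ) E(uⱼ⋆ ·)` for right `A`-linear maps `T`. -/
theorem linear_expand (T : B →ₗ[ℂ] B) (hT : ∀ b a, T (b * ι a) = T b * ι a) (b : B) :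
    ∑ j, T (E.qb j) * ι (E (star (E.qb j) * b)) = T b := by
  conv_rhs => rw [← E.qb_left b]
  simp [map_sum, hT]

/-- The sum `∑ T(uⱼ) uⱼ⋆` absorbs left multiplications inside `T`. -/
theorem trace_mul (T : B →ₗ[ℂ] B) (hT : ∀ b a, T (b * ι a) = T b * ι a) (b : B) :
    ∑ j, T (b * E.qb j) * star (E.qb j) = (∑ j, T (E.qb j) * star (E.qb j)) * b := by
  calc ∑ j, T (b * E.qb j) * star (E.qb j)
      = ∑ j, ∑ k, T (E.qb k) * ι (E (star (E.qb k) * b * E.qb j)) * star (E.qb j) := by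
        refine Finset.sum_congr rfl fun j _ => ?_
        rw [← E.linear_expand T hT (b * E.qb j), Finset.sum_mul]
        simp only [mul_assoc]
    _ = (∑ j, T (E.qb j) * star (E.qb j)) * b := by
        rw [Finset.sum_comm, Finset.sum_mul]
        refine Finset.sum_congr rfl fun k _ => ?_
        simp only [mul_assoc]
        rw [← Finset.mul_sum]
        simp only [← mul_assoc]
        rw [E.qb_right]
        simp only [mul_assoc]

theorem index_comm (b : B) : b * E.index = E.index * b := by
  have := E.trace_mul LinearMap.id (fun _ _ => rfl) b
  simp only [LinearMap.id_coe, id_eq] at this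
  rw [index, Finset.mul_sum, ← this]
  simp only [mul_assoc]

/-- The `A`-valued form in terms of coefficients. -/
theorem inner_expand (x y : B) :
    ∑ l, E (star x * E.qb l) * E (star (E.qb l) * y) = E (star x * y) := by
  conv_rhs => rw [← E.qb_left y, Finset.mul_sum, map_sum]
  simp only [← mul_assoc, apply_mul_incl]

end Index

end FaithfulCondExp

end Expectation

section Order

attribute [local instance] CStarAlgebra.spectralOrder CStarAlgebra.spectralOrderedRing

variable {A B : Type u} [CStarAlgebra A] [CStarAlgebra B] {ι : A →⋆ₐ[ℂ] B}
  (E : FaithfulCondExp ι) [E.IsIndexFinite]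

open FaithfulCondExp

theorem sum_star_mul_self_eq {n : ℕ} (d : Fin n → A) :
    ∃ a : A, ∑ l, star (d l) * d l = star a * a := by
  have h : 0 ≤ ∑ l, star (d l) * d l := Finset.sum_nonneg fun l _ => star_mul_self_nonneg _
  exact CStarAlgebra.nonneg_iff_eq_star_mul_self.mp h

theorem eq_zero_of_sum_star_mul_self {n : ℕ} (d : Fin n → A)
    (h : ∑ l, star (d l) * d l = 0) (l : Fin n) : d l = 0 := by
  have := (Finset.sum_eq_zero_iff_of_nonneg (fun l _ => star_mul_self_nonneg (d l))).mp h l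
    (Finset.mem_univ l)
  exact CStarRing.star_mul_self_eq_zero_iff _ |>.mp this

theorem norm_sum_mul_star_le {n : ℕ} (x y : Fin n → A) :
    ‖∑ l, y l * star (x l)‖ ≤ √‖∑ l, x l * star (x l)‖ * √‖∑ l, y l * star (y l)‖ :=
  CStarModule.norm_inner_le (A := A) (WithCStarModule A (Fin n → A))
    (x := (WithCStarModule.equiv A _).symm x) (y := (WithCStarModule.equiv A _).symm y)

theorem sqrt_norm_sum_add_le {n : ℕ} (x y : Fin n → A) :
    √‖∑ l, (x l + y l) * star (x l + y l)‖ ≤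
      √‖∑ l, x l * star (x l)‖ + √‖∑ l, y l * star (y l)‖ :=
  CStarModule.norm_triangle A (E := (WithCStarModule A (Fin n → A)))
    ((WithCStarModule.equiv A _).symm x) ((WithCStarModule.equiv A _).symm y)

theorem index_nonneg : 0 ≤ E.index := Finset.sum_nonneg fun _ _ => mul_star_self_nonneg _

theorem isUnit_index : IsUnit E.index := by
  have h1 := CStarModule.inner_mul_inner_swap_le (A := B) (E := (WithCStarModule B (Fin E.qbCard → B)))
    (x := (WithCStarModule.equiv B _).symm fun j => ι (E (E.qb j)))
    (y := (WithCStarModule.equiv B _).symm E.qb)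
  set r := ‖(WithCStarModule.equiv B _).symm fun j => ι (E (E.qb j))‖ ^ 2
  have h2 : ∑ j, E.qb j * star (ι (E (E.qb j))) = 1 := by
    have := E.qb_left 1
    simpa [← map_star, ← apply_star] using this
  have h3 : (1 : B) ≤ r • E.index := by
    have e1 : inner B ((WithCStarModule.equiv B (Fin E.qbCard → B)).symm
        fun j => ι (E (E.qb j))) ((WithCStarModule.equiv B _).symm E.qb) = 1 := h2
    have e2 : inner B ((WithCStarModule.equiv B (Fin E.qbCard → B)).symm E.qb)
        ((WithCStarModule.equiv B _).symm fun j => ι (E (E.qb j))) = 1 := by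
      rw [← CStarModule.star_inner, e1, star_one]
    rw [e1, e2, one_mul] at h1
    exact h1
  have h4 : IsUnit (r • E.index) := CStarAlgebra.isUnit_of_le 1 h3
  by_cases hr : r = 0
  · rw [hr, zero_smul] at h4
    have := isUnit_zero_iff.mp h4
    have : Subsingleton B := subsingleton_of_zero_eq_one this
    exact isUnit_of_subsingleton _
  · exact (isUnit_smul_iff (Units.mk0 r hr) E.index).mp h4

/-- A self-adjoint central square root of the index. -/
theorem exists_sqrt_index : ∃ r : B, star r = r ∧ r * r = E.index ∧ ∀ b, b * r = r * b := by
  refine ⟨CFC.sqrt E.index, (CFC.sqrt_nonneg _).isSelfAdjoint.star_eq,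
    CFC.sqrt_mul_sqrt_self _ (index_nonneg E), fun b => ?_⟩
  exact (Commute.cfcₙ_nnreal (show Commute E.index b from (E.index_comm b).symm) _).symm

theorem norm_le_of_positive (G : B →ₗ[ℂ] A) (h1 : ∀ a, G (ι a) = a)
    (h2 : ∀ a b, G (ι a * b) = a * G b) (h3 : ∀ b a, G (b * ι a) = G b * a)
    (hG : ∀ b : B, ∃ a : A, G (star b * b) = star a * a) (b : B) : ‖G b‖ ≤ ‖b‖ := by
  have pos : ∀ c : B, 0 ≤ c → 0 ≤ G c := fun c hc => by
    obtain ⟨d, rfl⟩ := CStarAlgebra.nonneg_iff_eq_star_mul_self.mp hc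
    obtain ⟨a, ha⟩ := hG d
    rw [ha]
    exact star_mul_self_nonneg a
  have e1 : star (G b) * G b ≤ G (star b * b) := by
    have h := pos _ (star_mul_self_nonneg (b - ι (G b)))
    have e : G (star (b - ι (G b)) * (b - ι (G b))) = G (star b * b) - star (G b) * G b := by
      simp only [star_sub, sub_mul, mul_sub, map_sub, ← map_star, h2, h3, h1,
        map_star_of_positive G hG]
      abel
    rw [e] at h
    exact sub_nonneg.mp h
  have e2 : G (star b * b) ≤ algebraMap ℝ A (‖b‖ ^ 2) := by
    have h := pos _ (sub_nonneg.mpr (CStarAlgebra.star_mul_le_algebraMap_norm_sq (a := b)))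
    have e : G (algebraMap ℝ B (‖b‖ ^ 2)) = algebraMap ℝ A (‖b‖ ^ 2) := by
      rw [Algebra.algebraMap_eq_smul_one, Algebra.algebraMap_eq_smul_one, G.map_smul_of_tower,
        ← map_one ι, h1]
    rw [map_sub, e] at h
    exact sub_nonneg.mp h
  have e3 := CStarAlgebra.norm_le_norm_of_nonneg_of_le (star_mul_self_nonneg (G b)) (e1.trans e2)
  have e4 : ‖algebraMap ℝ A (‖b‖ ^ 2)‖ ≤ ‖b‖ ^ 2 := by
    nontriviality A
    rw [norm_algebraMap, CStarRing.norm_one, mul_one]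
    simp
  rw [CStarRing.norm_star_mul_self] at e3
  nlinarith [norm_nonneg (G b), norm_nonneg b]

end Order

end CStarIndex

namespace CStarIndex

namespace FaithfulCondExp

section Module

variable {A B : Type u} [CStarAlgebra A] [CStarAlgebra B] {ι : A →⋆ₐ[ℂ] B}
  (E : FaithfulCondExp ι)

/-- The Hilbert `A`-module of `E`: the space `B`, to be normed by `‖x‖ = ‖E (x⋆ x)‖ ^ (1/2)`. If
`E` has index-finite type, this is already complete (see the `CompleteSpace` instance below). -/
def HilbertModule (_E : FaithfulCondExp ι) : Type u := B

noncomputable instance : AddCommGroup E.HilbertModule := inferInstanceAs (AddCommGroup B)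

noncomputable instance : Module ℂ E.HilbertModule := inferInstanceAs (Module ℂ B)

/-- The identity map from `B` to its Hilbert module. -/
noncomputable def eta : B ≃ₗ[ℂ] E.HilbertModule := LinearEquiv.refl ℂ B

/-- The `A`-valued inner product `⟪x, y⟫ = E (x⋆ y)`. -/
noncomputable def ip (x y : E.HilbertModule) : A := E (star (E.eta.symm x) * E.eta.symm y)

noncomputable instance : Norm E.HilbertModule where
  norm x := √‖E.ip x x‖

theorem norm_eta (b : B) : ‖E.eta b‖ = √‖E (star b * b)‖ := rfl

theorem ip_eta (x y : B) : E.ip (E.eta x) (E.eta y) = E (star x * y) := rfl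

theorem star_ip (x y : E.HilbertModule) : star (E.ip x y) = E.ip y x := by
  simp [ip, ← apply_star]

theorem norm_sq_eq (x : E.HilbertModule) : ‖x‖ * ‖x‖ = ‖E.ip x x‖ :=
  Real.mul_self_sqrt (norm_nonneg _)

theorem norm_eta_le (b : B) : ‖E.eta b‖ ≤ ‖b‖ := by
  rw [norm_eta]
  refine Real.sqrt_le_iff.mpr ⟨norm_nonneg _, ?_⟩
  rw [sq, ← CStarRing.norm_star_mul_self]
  exact E.norm_le _

theorem ext_ip {x y : E.HilbertModule} (h : ∀ z, E.ip z x = E.ip z y) : x = y := by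
  rw [← sub_eq_zero]
  have : E.ip (x - y) (x - y) = 0 := by
    have := h (x - y)
    simp only [ip, map_sub, mul_sub] at this ⊢
    exact sub_eq_zero.mpr this
  exact (LinearEquiv.map_eq_zero_iff _).mp (E.faithful (E.eta.symm (x - y)) this)

variable [E.IsIndexFinite]

theorem norm_ip_le (x y : E.HilbertModule) : ‖E.ip x y‖ ≤ ‖x‖ * ‖y‖ := by
  have h := norm_sum_mul_star_le (fun l => E (star (E.eta.symm y) * E.qb l))
    (fun l => E (star (E.eta.symm x) * E.qb l))
  simp only [← apply_star, star_mul, star_star, inner_expand] at h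
  rw [mul_comm] at h
  exact h

theorem normCore : NormedSpace.Core ℂ E.HilbertModule where
  norm_nonneg _ := Real.sqrt_nonneg _
  norm_smul c x := by
    change √‖E.ip (c • x) (c • x)‖ = ‖c‖ * √‖E.ip x x‖
    have : E.ip (c • x) (c • x) = (star c * c) • E.ip x x := by
      simp [ip, smul_smul, mul_comm]
    rw [this, norm_smul, norm_mul, norm_star, Real.sqrt_mul (by positivity),
      Real.sqrt_mul_self (norm_nonneg c)]
  norm_triangle x y := by
    have h := sqrt_norm_sum_add_le (fun l => E (star (E.eta.symm x) * E.qb l))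
      (fun l => E (star (E.eta.symm y) * E.qb l))
    simp only [← map_add, ← add_mul, ← star_add] at h
    simp only [← apply_star, star_mul, star_star, inner_expand] at h
    exact h
  norm_eq_zero_iff x := by
    constructor
    · intro h
      have h1 : ‖E.ip x x‖ = 0 := (Real.sqrt_eq_zero (norm_nonneg _)).mp h
      have h2 := E.faithful (E.eta.symm x) (norm_eq_zero.mp h1)
      exact (LinearEquiv.map_eq_zero_iff _).mp h2
    · rintro rfl
      change √‖E.ip 0 0‖ = 0
      simp [ip]

noncomputable instance : NormedAddCommGroup E.HilbertModule := NormedAddCommGroup.ofCore E.normCore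

noncomputable instance : NormedSpace ℂ E.HilbertModule := NormedSpace.ofCore E.normCore

theorem norm_le_eta (b : B) : ‖b‖ ≤ (∑ j, ‖E.qb j‖ * ‖E.eta (E.qb j)‖) * ‖E.eta b‖ := by
  conv_lhs => rw [← E.qb_left b]
  rw [Finset.sum_mul]
  refine (norm_sum_le _ _).trans (Finset.sum_le_sum fun j _ => ?_)
  rw [mul_assoc]
  refine (norm_mul_le _ _).trans (mul_le_mul_of_nonneg_left ?_ (norm_nonneg _))
  exact (NonUnitalStarAlgHom.norm_apply_le ι _).trans (E.norm_ip_le (E.eta (E.qb j)) (E.eta b))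

/-- `B` and the Hilbert module have equivalent norms. -/
noncomputable def etaL : B ≃L[ℂ] E.HilbertModule :=
  LinearEquiv.toContinuousLinearEquivOfBounds E.eta 1 (∑ j, ‖E.qb j‖ * ‖E.eta (E.qb j)‖)
    (fun b => by rw [one_mul]; exact E.norm_eta_le b) (fun x => E.norm_le_eta (E.eta.symm x))

instance : CompleteSpace E.HilbertModule :=
  (completeSpace_congr (e := E.etaL.toEquiv) E.etaL.isUniformEmbedding).mp inferInstance

/-- The adjointable operators on the Hilbert module, as an algebra of bounded operators. -/
noncomputable def adjointable : Subalgebra ℂ (E.HilbertModule →L[ℂ] E.HilbertModule) where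
  carrier := {T | ∃ S : E.HilbertModule →L[ℂ] E.HilbertModule, ∀ x y, E.ip (T x) y = E.ip x (S y)}
  mul_mem' := by
    rintro T T' ⟨S, hS⟩ ⟨S', hS'⟩
    exact ⟨S' * S, fun x y => (hS _ _).trans (hS' _ _)⟩
  add_mem' := by
    rintro T T' ⟨S, hS⟩ ⟨S', hS'⟩
    refine ⟨S + S', fun x y => ?_⟩
    have h1 := hS x y
    have h2 := hS' x y
    simp only [ip] at h1 h2 ⊢
    simp [add_mul, mul_add, h1, h2]
  algebraMap_mem' c := by
    refine ⟨star c • 1, fun x y => ?_⟩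
    simp [ip, Algebra.algebraMap_eq_smul_one]

/-- The C⋆-algebra of adjointable operators on the Hilbert module of `E`. -/
abbrev Adjointable : Type u := E.adjointable

variable {E}

theorem Adjointable.exists_adjoint (T : E.Adjointable) :
    ∃ S : E.Adjointable, ∀ x y, E.ip (T.1 x) y = E.ip x (S.1 y) := by
  obtain ⟨S, hS⟩ := T.2
  refine ⟨⟨S, T.1, fun x y => ?_⟩, hS⟩
  rw [← E.star_ip, ← hS, E.star_ip]

noncomputable instance : Star E.Adjointable where
  star T := T.exists_adjoint.choose

theorem Adjointable.ip_left (T : E.Adjointable) (x y : E.HilbertModule) :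
    E.ip (T.1 x) y = E.ip x ((star T).1 y) := T.exists_adjoint.choose_spec x y

theorem Adjointable.ip_right (T : E.Adjointable) (x y : E.HilbertModule) :
    E.ip ((star T).1 x) y = E.ip x (T.1 y) := by
  rw [← E.star_ip, ← T.ip_left, E.star_ip]

theorem Adjointable.star_eq {T S : E.Adjointable} (h : ∀ x y, E.ip (T.1 x) y = E.ip x (S.1 y)) :
    star T = S := by
  refine Subtype.ext (ContinuousLinearMap.ext fun y => E.ext_ip fun z => ?_)
  rw [← T.ip_left, h]

noncomputable instance : StarRing E.Adjointable where
  star_involutive T := Adjointable.star_eq fun x y => T.ip_right x y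
  star_mul S T := Adjointable.star_eq fun x y => by
    change E.ip (S.1 (T.1 x)) y = E.ip x ((star T).1 ((star S).1 y))
    rw [S.ip_left, T.ip_left]
  star_add S T := Adjointable.star_eq fun x y => by
    have h1 := S.ip_left x y
    have h2 := T.ip_left x y
    simp only [ip] at h1 h2 ⊢
    simp [add_mul, mul_add, h1, h2]

instance : StarModule ℂ E.Adjointable where
  star_smul c T := Adjointable.star_eq fun x y => by
    have h1 := T.ip_left x y
    simp only [ip] at h1 ⊢
    simp [h1]

instance : CStarRing E.Adjointable where
  norm_mul_self_le T := by
    rw [← sq]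
    refine (Real.le_sqrt (norm_nonneg _) (norm_nonneg _)).mp ?_
    refine ContinuousLinearMap.opNorm_le_bound T.1 (Real.sqrt_nonneg _) fun x => ?_
    refine (Real.le_sqrt_of_sq_le (y := ‖star T * T‖ * ‖x‖ ^ 2) ?_).trans ?_
    · rw [sq, norm_sq_eq, T.ip_left, sq, ← mul_assoc, mul_comm]
      refine (E.norm_ip_le _ _).trans (mul_le_mul_of_nonneg_left ?_ (norm_nonneg _))
      exact (star T * T).1.le_opNorm x
    · rw [Real.sqrt_mul (norm_nonneg (star T * T)), Real.sqrt_sq (norm_nonneg x)]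
      exact le_refl _

/-- Adjointable operators are right `A`-linear. -/
theorem Adjointable.map_mul_incl (T : E.Adjointable) (b : B) (a : A) :
    E.eta.symm (T.1 (E.eta (b * ι a))) = E.eta.symm (T.1 (E.eta b)) * ι a := by
  refine E.eta.injective (E.ext_ip fun z => ?_)
  rw [LinearEquiv.apply_symm_apply, ← T.ip_right]
  have := T.ip_right z (E.eta b)
  simp only [ip, LinearEquiv.symm_apply_apply, ← mul_assoc, apply_mul_incl] at this ⊢
  rw [this]

variable (E)

/-- Right `A`-linear maps `B → B` are adjointable. -/
noncomputable def ofLinear (T : B →ₗ[ℂ] B) (hT : ∀ b a, T (b * ι a) = T b * ι a) :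
    E.Adjointable :=
  have bd : ∀ S : B →ₗ[ℂ] B, (∀ b a, S (b * ι a) = S b * ι a) → ∃ C, ∀ b, ‖S b‖ ≤ C * ‖b‖ :=
    fun S hS => ⟨∑ j, ‖S (E.qb j)‖ * ‖star (E.qb j)‖, fun b => by
      conv_lhs => rw [← E.linear_expand S hS b]
      rw [Finset.sum_mul]
      refine (norm_sum_le _ _).trans (Finset.sum_le_sum fun j _ => ?_)
      rw [mul_assoc]
      refine (norm_mul_le _ _).trans (mul_le_mul_of_nonneg_left ?_ (norm_nonneg _))
      exact (NonUnitalStarAlgHom.norm_apply_le ι _).trans ((E.norm_le _).trans (norm_mul_le _ _))⟩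
  let S : B →ₗ[ℂ] B := ∑ j, LinearMap.mulLeft ℂ (E.qb j) ∘ₗ ι.toAlgHom.toLinearMap ∘ₗ
    E.toLinearMap ∘ₗ LinearMap.mulLeft ℂ (star (T (E.qb j)))
  have hS' : ∀ b, S b = ∑ j, E.qb j * ι (E (star (T (E.qb j)) * b)) := fun b => by
    simp [S]; rfl
  have hS : ∀ b a, S (b * ι a) = S b * ι a := fun b a => by
    simp only [hS', ← mul_assoc, apply_mul_incl, map_mul, Finset.sum_mul]
  ⟨E.etaL.toContinuousLinearMap ∘L T.mkContinuousOfExistsBound (bd T hT) ∘L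
      E.etaL.symm.toContinuousLinearMap,
    E.etaL.toContinuousLinearMap ∘L S.mkContinuousOfExistsBound (bd S hS) ∘L
      E.etaL.symm.toContinuousLinearMap, fun x y => by
    change E (star (T (E.eta.symm x)) * E.eta.symm y) = E (star (E.eta.symm x) * S (E.eta.symm y))
    rw [hS', ← E.linear_expand T hT, star_sum, Finset.sum_mul, Finset.mul_sum, map_sum, map_sum]
    refine Finset.sum_congr rfl fun j _ => ?_
    rw [star_mul, ← map_star, ← apply_star, star_mul, star_star, mul_assoc, apply_incl_mul,
      ← mul_assoc, apply_mul_incl]⟩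

theorem ofLinear_apply (T : B →ₗ[ℂ] B) (hT : ∀ b a, T (b * ι a) = T b * ι a) (b : B) :
    E.eta.symm ((E.ofLinear T hT).1 (E.eta b)) = T b := rfl

theorem isClosed_adjointable :
    IsClosed (E.adjointable : Set (E.HilbertModule →L[ℂ] E.HilbertModule)) := by
  have : (E.adjointable : Set (E.HilbertModule →L[ℂ] E.HilbertModule)) =
      ⋂ (b : B) (a : A), {T | E.etaL.symm (T (E.eta (b * ι a))) =
        E.etaL.symm (T (E.eta b)) * ι a} := by
    ext T
    simp only [Set.mem_iInter, Set.mem_ofPred_eq, SetLike.mem_coe]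
    constructor
    · intro hT b a
      exact Adjointable.map_mul_incl ⟨T, hT⟩ b a
    · intro h
      have := (E.ofLinear (E.eta.symm.toLinearMap ∘ₗ T.toLinearMap ∘ₗ E.eta.toLinearMap) h).2
      exact this
  rw [this]
  refine isClosed_iInter fun b => isClosed_iInter fun a => isClosed_eq ?_ ?_ <;> fun_prop

instance : CompleteSpace E.Adjointable := E.isClosed_adjointable.completeSpace_coe

noncomputable instance : CStarAlgebra E.Adjointable where

end Module

end FaithfulCondExp

end CStarIndex

namespace CStarIndex

namespace FaithfulCondExp

section Basic

variable {A B : Type u} [CStarAlgebra A] [CStarAlgebra B] {ι : A →⋆ₐ[ℂ] B}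
  (E : FaithfulCondExp ι) [E.IsIndexFinite]

/-- The representation of `B` on its Hilbert module by left multiplication. -/
noncomputable def lambda : B →⋆ₐ[ℂ] E.Adjointable where
  toFun b := E.ofLinear (LinearMap.mulLeft ℂ b) (fun _ _ => (mul_assoc _ _ _).symm)
  map_one' := Subtype.ext <| ContinuousLinearMap.ext fun x => one_mul (E.eta.symm x)
  map_mul' a b := Subtype.ext <| ContinuousLinearMap.ext fun x => mul_assoc a b (E.eta.symm x)
  map_zero' := Subtype.ext <| ContinuousLinearMap.ext fun x => zero_mul (E.eta.symm x)
  map_add' a b := Subtype.ext <| ContinuousLinearMap.ext fun x => add_mul a b (E.eta.symm x)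
  commutes' c := Subtype.ext <| ContinuousLinearMap.ext fun x =>
    show algebraMap ℂ B c * E.eta.symm x = c • E.eta.symm x from (Algebra.smul_def _ _).symm
  map_star' b := Eq.symm <| Adjointable.star_eq fun x y =>
    show E (star (b * E.eta.symm x) * E.eta.symm y) = E (star (E.eta.symm x) * (star b *
      E.eta.symm y)) by rw [star_mul, mul_assoc]

/-- The Jones projection: the expectation `E` as an operator on the Hilbert module. -/
noncomputable def jones : E.Adjointable :=
  E.ofLinear (ι.toAlgHom.toLinearMap ∘ₗ E.toLinearMap) fun b a =>
    show ι (E (b * ι a)) = ι (E b) * ι a by rw [apply_mul_incl, map_mul]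

theorem lambda_apply (b x : B) : E.eta.symm ((E.lambda b).1 (E.eta x)) = b * x := rfl

theorem jones_apply (x : B) : E.eta.symm (E.jones.1 (E.eta x)) = ι (E x) := rfl

theorem star_jones : star E.jones = E.jones :=
  Adjointable.star_eq fun x y =>
    show E (star (ι (E (E.eta.symm x))) * E.eta.symm y) =
      E (star (E.eta.symm x) * ι (E (E.eta.symm y))) by
    rw [← map_star, apply_incl_mul, apply_mul_incl, apply_star]

theorem jones_mul_self : E.jones * E.jones = E.jones :=
  Subtype.ext <| ContinuousLinearMap.ext fun x =>
    show ι (E (ι (E (E.eta.symm x)))) = ι (E (E.eta.symm x)) by rw [apply_incl]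

theorem jones_lambda_jones (b : B) :
    E.jones * E.lambda b * E.jones = E.lambda (ι (E b)) * E.jones :=
  Subtype.ext <| ContinuousLinearMap.ext fun x =>
    show ι (E (b * ι (E (E.eta.symm x)))) = ι (E b) * ι (E (E.eta.symm x)) by
    rw [apply_mul_incl, map_mul]

/-- `C⋆(B, e)`: the C⋆-algebra of operators generated by `B` and the Jones projection. -/
noncomputable def basicSubalgebra : StarSubalgebra ℂ E.Adjointable :=
  (StarAlgebra.adjoin ℂ (Set.range E.lambda ∪ {E.jones})).topologicalClosure

/-- The C⋆-basic construction `C⋆(B, e)` for `E`. -/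
def BasicConstruction : Type u := E.basicSubalgebra

noncomputable instance : CStarAlgebra E.BasicConstruction :=
  StarSubalgebra.cstarAlgebra E.basicSubalgebra
    (h_closed := StarSubalgebra.isClosed_topologicalClosure _)

/-- The elements of the basic construction as operators. -/
noncomputable def toAdjointable : E.BasicConstruction →⋆ₐ[ℂ] E.Adjointable :=
  E.basicSubalgebra.subtype

theorem toAdjointable_injective : Function.Injective E.toAdjointable := Subtype.val_injective

/-- The canonical inclusion of `B` in the basic construction. -/
noncomputable def incl : B →⋆ₐ[ℂ] E.BasicConstruction :=
  StarAlgHom.codRestrict E.lambda E.basicSubalgebra fun b =>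
    StarSubalgebra.le_topologicalClosure _
      (StarAlgebra.subset_adjoin ℂ _ (Or.inl ⟨b, rfl⟩))

/-- The Jones projection as an element of the basic construction. -/
noncomputable def jonesProj : E.BasicConstruction :=
  ⟨E.jones, StarSubalgebra.le_topologicalClosure _
    (StarAlgebra.subset_adjoin ℂ _ (Or.inr rfl))⟩

theorem toAdjointable_incl (b : B) : E.toAdjointable (E.incl b) = E.lambda b := rfl

theorem toAdjointable_jonesProj : E.toAdjointable E.jonesProj = E.jones := rfl

theorem star_jonesProj : star E.jonesProj = E.jonesProj := Subtype.ext E.star_jones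

/-- The operator on `B` underlying an element of the basic construction. -/
noncomputable def op (T : E.BasicConstruction) : B →ₗ[ℂ] B :=
  E.eta.symm.toLinearMap ∘ₗ (E.toAdjointable T).1.toLinearMap ∘ₗ E.eta.toLinearMap

variable {E} in
theorem op_ext {S T : E.BasicConstruction} (h : ∀ b, E.op S b = E.op T b) : S = T :=
  E.toAdjointable_injective <| Subtype.ext <| ContinuousLinearMap.ext fun x =>
    E.eta.symm.injective (h (E.eta.symm x))

theorem op_mul_incl (T : E.BasicConstruction) (b : B) (a : A) :
    E.op T (b * ι a) = E.op T b * ι a := Adjointable.map_mul_incl _ b a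

theorem op_mul (S T : E.BasicConstruction) (b : B) : E.op (S * T) b = E.op S (E.op T b) := rfl

theorem op_add (S T : E.BasicConstruction) (b : B) : E.op (S + T) b = E.op S b + E.op T b := rfl

theorem op_smul (c : ℂ) (T : E.BasicConstruction) (b : B) : E.op (c • T) b = c • E.op T b := rfl

theorem op_incl (b x : B) : E.op (E.incl b) x = b * x := rfl

theorem op_jonesProj (x : B) : E.op E.jonesProj x = ι (E x) := rfl

theorem op_sum {n : ℕ} (T : Fin n → E.BasicConstruction) (b : B) :
    E.op (∑ j, T j) b = ∑ j, E.op (T j) b := by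
  induction n with
  | zero => rfl
  | succ n ih => rw [Fin.sum_univ_succ, Fin.sum_univ_succ, op_add, ih]

theorem op_star (T : E.BasicConstruction) (x y : B) :
    E (star x * E.op (star T) y) = E (star (E.op T x) * y) := by
  have := (E.toAdjointable T).ip_left (E.eta x) (E.eta y)
  rw [← map_star] at this
  exact this.symm

/-- The formula `T ↦ Index(E)⁻¹ ∑ T(uⱼ) uⱼ⋆` for the dual expectation. -/
noncomputable def dualFun (T : E.BasicConstruction) : B :=
  Ring.inverse E.index * ∑ j, E.op T (E.qb j) * star (E.qb j)

theorem inverse_comm (b : B) : b * Ring.inverse E.index = Ring.inverse E.index * b := by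
  obtain ⟨v, hv⟩ := isUnit_index E
  have h : Commute b (v : B) := by rw [hv]; exact E.index_comm b
  rw [← hv, Ring.inverse_unit]
  exact h.units_inv_right

/-- `Index(E) E₂(S⋆ S)` as a sum of squares. -/
theorem dual_star_mul_self (S : E.BasicConstruction) :
    ∑ j, E.op (star S * S) (E.qb j) * star (E.qb j) =
      ∑ l, star (∑ k, ι (E (star (E.qb l) * E.op S (E.qb k))) * star (E.qb k)) *
        ∑ k, ι (E (star (E.qb l) * E.op S (E.qb k))) * star (E.qb k) := by
  have h1 : ∀ j, E.op (star S * S) (E.qb j) =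
      ∑ k, E.qb k * ι (E (star (E.op S (E.qb k)) * E.op S (E.qb j))) := fun j => by
    conv_lhs => rw [← E.qb_left (E.op (star S * S) (E.qb j))]
    refine Finset.sum_congr rfl fun k _ => ?_
    rw [op_mul, op_star]
  have h2 : ∀ j k, E (star (E.op S (E.qb k)) * E.op S (E.qb j)) =
      ∑ l, E (star (E.op S (E.qb k)) * E.qb l) * E (star (E.qb l) * E.op S (E.qb j)) :=
    fun j k => (E.inner_expand _ _).symm
  simp only [h1, h2, map_sum, map_mul, star_sum, star_mul, star_star, ← map_star,
    ← apply_star, Finset.mul_sum, Finset.sum_mul]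
  rw [Finset.sum_comm]
  conv_lhs => enter [2, k]; rw [Finset.sum_comm]
  rw [Finset.sum_comm]
  refine Finset.sum_congr rfl fun l _ => ?_
  rw [Finset.sum_comm]
  refine Finset.sum_congr rfl fun j _ => Finset.sum_congr rfl fun k _ => ?_
  simp only [mul_assoc]

theorem exists_sqrt_inverse :
    ∃ w : B, star w = w ∧ w * w = Ring.inverse E.index ∧ ∀ b, b * w = w * b := by
  obtain ⟨r, hr, hrr, hc⟩ := exists_sqrt_index E
  have hu := isUnit_index E
  have hs : star E.index = E.index := by rw [← hrr, star_mul, hr]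
  refine ⟨r * Ring.inverse E.index, ?_, ?_, fun b => ?_⟩
  · rw [star_mul, hr, hc, ← Ring.inverse_star, hs]
  · rw [mul_assoc, ← mul_assoc _ r, ← E.inverse_comm, ← mul_assoc, ← mul_assoc, hrr,
      Ring.mul_inverse_cancel _ hu, one_mul]
  · rw [← mul_assoc, hc, mul_assoc, E.inverse_comm, mul_assoc]

theorem dualFun_add (S T : E.BasicConstruction) :
    E.dualFun (S + T) = E.dualFun S + E.dualFun T := by
  simp only [dualFun, op_add, add_mul, Finset.sum_add_distrib, mul_add]

theorem dualFun_smul (c : ℂ) (T : E.BasicConstruction) :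
    E.dualFun (c • T) = c • E.dualFun T := by
  simp only [dualFun, op_smul, smul_mul_assoc, ← Finset.smul_sum, mul_smul_comm]

theorem dualFun_incl_mul (b : B) (T : E.BasicConstruction) :
    E.dualFun (E.incl b * T) = b * E.dualFun T := by
  simp only [dualFun, op_mul, op_incl, mul_assoc, ← Finset.mul_sum]
  rw [← mul_assoc, ← mul_assoc, E.inverse_comm]

theorem dualFun_mul_incl (T : E.BasicConstruction) (b : B) :
    E.dualFun (T * E.incl b) = E.dualFun T * b := by
  simp only [dualFun, op_mul, op_incl]
  rw [E.trace_mul (E.op T) (E.op_mul_incl T) b, mul_assoc]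

theorem dualFun_incl (b : B) : E.dualFun (E.incl b) = b := by
  simp only [dualFun, op_incl, mul_assoc, ← Finset.mul_sum]
  rw [← index, E.index_comm, ← mul_assoc, Ring.inverse_mul_cancel _ (isUnit_index E), one_mul]

theorem dualFun_positive (S : E.BasicConstruction) :
    ∃ a : B, E.dualFun (star S * S) = star a * a := by
  obtain ⟨a, ha⟩ := sum_star_mul_self_eq
    (fun l => ∑ k, ι (E (star (E.qb l) * E.op S (E.qb k))) * star (E.qb k))
  obtain ⟨w, hw, hww, hc⟩ := E.exists_sqrt_inverse
  refine ⟨a * w, ?_⟩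
  rw [dualFun, dual_star_mul_self, ha, ← hww, star_mul, hw, hc a]
  simp only [← mul_assoc]
  rw [mul_assoc w w (star a), ← hc (star a), ← mul_assoc, ← hc (star a)]

theorem dualFun_faithful (S : E.BasicConstruction) (h : E.dualFun (star S * S) = 0) : S = 0 := by
  have h1 : ∑ j, E.op (star S * S) (E.qb j) * star (E.qb j) = 0 := by
    have := congrArg (E.index * ·) h
    simpa [dualFun, ← mul_assoc, Ring.mul_inverse_cancel _ (isUnit_index E)] using this
  rw [dual_star_mul_self] at h1
  have h2 := eq_zero_of_sum_star_mul_self _ h1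
  refine op_ext fun b => ?_
  change E.op S b = 0
  rw [← E.qb_left (E.op S b)]
  refine Finset.sum_eq_zero fun l _ => ?_
  have h3 := congrArg (fun x => E (x * b)) (h2 l)
  simp only [Finset.sum_mul, map_sum, zero_mul, map_zero, mul_assoc, apply_incl_mul] at h3
  rw [← E.linear_expand (E.op S) (E.op_mul_incl S) b, Finset.mul_sum, map_sum]
  simp only [← mul_assoc, apply_mul_incl]
  simp only [h3, map_zero, mul_zero]

/-- The dual conditional expectation `E₂ : C⋆(B, e) → B`; see `dual_apply`. -/
noncomputable def dual : FaithfulCondExp E.incl where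
  toFun := E.dualFun
  map_add' := E.dualFun_add
  map_smul' := E.dualFun_smul
  map_incl := E.dualFun_incl
  map_incl_mul := E.dualFun_incl_mul
  map_mul_incl := E.dualFun_mul_incl
  positive := E.dualFun_positive
  norm_le := norm_le_of_positive (ι := E.incl)
    ⟨⟨E.dualFun, E.dualFun_add⟩, E.dualFun_smul⟩ E.dualFun_incl E.dualFun_incl_mul
    E.dualFun_mul_incl E.dualFun_positive
  faithful := E.dualFun_faithful

theorem dual_eq (T : E.BasicConstruction) : E.dual T = E.dualFun T := rfl

/-- The defining formula `E₂ (x e y) = Index(E)⁻¹ x y`. -/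
theorem dual_apply (x y : B) :
    E.dual (E.incl x * E.jonesProj * E.incl y) = Ring.inverse E.index * x * y := by
  rw [dual_eq, dualFun, mul_assoc (Ring.inverse E.index)]
  congr 1
  simp only [op_mul, op_incl, op_jonesProj, mul_assoc, ← Finset.mul_sum, E.qb_right]

instance : E.dual.IsIndexFinite where
  exists_quasiBasis := by
    obtain ⟨r, hr, hrr, hc⟩ := exists_sqrt_index E
    refine ⟨E.qbCard, fun j => E.incl (E.qb j) * E.jonesProj * E.incl r,
      IsQuasiBasis.of_left _ fun T => op_ext fun b => ?_⟩
    have hk : r * Ring.inverse E.index * r = 1 := by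
      rw [E.inverse_comm, mul_assoc, hrr, Ring.inverse_mul_cancel _ (isUnit_index E)]
    have hdual : ∀ j, E.dual (star (E.incl (E.qb j) * E.jonesProj * E.incl r) * T) =
        Ring.inverse E.index * r * ∑ k, ι (E (star (E.qb j) * E.op T (E.qb k))) *
          star (E.qb k) := fun j => by
      rw [star_mul, star_mul, ← map_star, ← map_star, hr, star_jonesProj, mul_assoc,
        dual_eq, dualFun_incl_mul, dualFun]
      simp only [op_mul, op_incl, op_jonesProj]
      rw [← mul_assoc, ← E.inverse_comm]
    have hterm : ∀ j, E.op (E.incl (E.qb j) * E.jonesProj * E.incl r *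
        E.incl (E.dual (star (E.incl (E.qb j) * E.jonesProj * E.incl r) * T))) b =
        E.qb j * ι (E (star (E.qb j) * E.op T b)) := fun j => by
      rw [hdual]
      simp only [op_mul, op_incl, op_jonesProj]
      have : r * (Ring.inverse E.index * r * (∑ k, ι (E (star (E.qb j) * E.op T (E.qb k))) *
          star (E.qb k)) * b) = (∑ k, ι (E (star (E.qb j) * E.op T (E.qb k))) *
          star (E.qb k)) * b := by
        simp only [← mul_assoc]
        rw [hk, one_mul]
      rw [this, Finset.sum_mul, map_sum]
      congr 2
      rw [← E.linear_expand (E.op T) (E.op_mul_incl T) b, Finset.mul_sum, map_sum]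
      refine Finset.sum_congr rfl fun k _ => ?_
      rw [mul_assoc, apply_incl_mul, ← mul_assoc, apply_mul_incl]
    rw [op_sum]
    simp only [hterm]
    exact E.qb_left _

end Basic

end FaithfulCondExp

end CStarIndex

namespace CStarIndex

namespace FaithfulCondExp

section Comp

variable {A B C : Type u} [CStarAlgebra A] [CStarAlgebra B] [CStarAlgebra C]

variable (A) in
/-- The identity map as a conditional expectation `A → A`. -/
noncomputable def refl : FaithfulCondExp (StarAlgHom.id ℂ A) where
  toLinearMap := LinearMap.id
  map_incl _ := rfl
  map_incl_mul _ _ := rfl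
  map_mul_incl _ _ := rfl
  positive b := ⟨b, rfl⟩
  norm_le _ := le_rfl
  faithful b h := (CStarRing.star_mul_self_eq_zero_iff b).mp h

instance : (refl A).IsIndexFinite where
  exists_quasiBasis := ⟨1, fun _ => 1, IsQuasiBasis.of_left _ fun b => by
    have : (refl A) b = b := rfl
    simp [this]⟩

variable {ι : A →⋆ₐ[ℂ] B} {κ : B →⋆ₐ[ℂ] C}

/-- The composition `E ∘ F : C → A` of conditional expectations. -/
noncomputable def comp (E : FaithfulCondExp ι) (F : FaithfulCondExp κ) : FaithfulCondExp (κ.comp ι) where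
  toLinearMap := E.toLinearMap ∘ₗ F.toLinearMap
  map_incl a := show E (F (κ (ι a))) = a by rw [apply_incl, apply_incl]
  map_incl_mul a c := show E (F (κ (ι a) * c)) = a * E (F c) by
    rw [apply_incl_mul, apply_incl_mul]
  map_mul_incl c a := show E (F (c * κ (ι a))) = E (F c) * a by
    rw [apply_mul_incl, apply_mul_incl]
  positive c := by
    obtain ⟨b, hb⟩ := F.positive c
    obtain ⟨a, ha⟩ := E.positive b
    exact ⟨a, (congrArg E hb).trans ha⟩
  norm_le c := (E.norm_le _).trans (F.norm_le c)
  faithful c h := by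
    obtain ⟨b, hb⟩ := F.positive c
    have h1 : E (star b * b) = 0 := (congrArg E hb).symm.trans h
    have h2 := E.faithful b h1
    refine F.faithful c (hb.trans ?_)
    rw [h2, mul_zero]

theorem comp_apply (E : FaithfulCondExp ι) (F : FaithfulCondExp κ) (c : C) :
    (E.comp F) c = E (F c) := rfl

instance (E : FaithfulCondExp ι) (F : FaithfulCondExp κ) [E.IsIndexFinite] [F.IsIndexFinite] :
    (E.comp F).IsIndexFinite where
  exists_quasiBasis := by
    refine ⟨F.qbCard * E.qbCard,
      fun j => F.qb (finProdFinEquiv.symm j).1 * κ (E.qb (finProdFinEquiv.symm j).2),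
      IsQuasiBasis.of_left _ fun c => ?_⟩
    rw [finProdFinEquiv.symm.sum_comp (fun p : Fin F.qbCard × Fin E.qbCard =>
      F.qb p.1 * κ (E.qb p.2) * (κ.comp ι) ((E.comp F) (star (F.qb p.1 * κ (E.qb p.2)) * c))),
      Fintype.sum_prod_type]
    conv_rhs => rw [← F.qb_left c]
    refine Finset.sum_congr rfl fun i _ => ?_
    conv_rhs => rw [← E.qb_left (F (star (F.qb i) * c)), map_sum, Finset.mul_sum]
    refine Finset.sum_congr rfl fun j _ => ?_
    rw [comp_apply, star_mul, ← map_star, mul_assoc (κ (star (E.qb j))), apply_incl_mul, map_mul κ,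
      mul_assoc]
    rfl

end Comp

end FaithfulCondExp

/-- A unital inclusion `A → B` of unital C⋆-algebras with a faithful conditional expectation of
index-finite type. -/
structure FiniteIndexInclusion where
  A : Type u
  B : Type u
  [instA : CStarAlgebra A]
  [instB : CStarAlgebra B]
  ι : A →⋆ₐ[ℂ] B
  E : FaithfulCondExp ι
  [finite : E.IsIndexFinite]

namespace FiniteIndexInclusion

attribute [instance] instA instB finite

/-- From `E : B → A` to the dual expectation `C⋆(B, e) → B`. -/
noncomputable def next (I : FiniteIndexInclusion.{u}) : FiniteIndexInclusion.{u} where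
  A := I.B
  B := I.E.BasicConstruction
  ι := I.E.incl
  E := I.E.dual

/-- The inclusion `ι : A → B` with the expectation `E`, bundled. -/
def of {A B : Type u} [CStarAlgebra A] [CStarAlgebra B] {ι : A →⋆ₐ[ℂ] B}
    (E : FaithfulCondExp ι) [E.IsIndexFinite] : FiniteIndexInclusion.{u} where
  A := A
  B := B
  ι := ι
  E := E

variable (I : FiniteIndexInclusion.{u})

/-- The `k`-th inclusion `B_k → B_{k+1}` of the tower of iterated basic constructions, with its
conditional expectation `E_{k+1}`. -/
noncomputable def level : ℕ → FiniteIndexInclusion.{u}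
  | 0 => I
  | k + 1 => (level k).next

/-- The C⋆-algebra `B_k` of the tower of iterated basic constructions
`B_0 = A, B_1 = B, B_{k+1} = C⋆(B_k, e_k)`. -/
def alg (k : ℕ) : Type u := (I.level k).A

noncomputable instance (k : ℕ) : CStarAlgebra (I.alg k) := (I.level k).instA

/-- The inclusion `B_k → B_{k+1}`. -/
noncomputable def step (k : ℕ) : I.alg k →⋆ₐ[ℂ] I.alg (k + 1) := (I.level k).ι

/-- The conditional expectation `E_{k+1} : B_{k+1} → B_k`. -/
noncomputable def expectation (k : ℕ) : FaithfulCondExp (I.step k) := (I.level k).E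

instance (k : ℕ) : (I.expectation k).IsIndexFinite := (I.level k).finite

/-- The inclusion `B_n → B_m` for `n ≤ m`. -/
noncomputable def towerIncl {n m : ℕ} (h : n ≤ m) : I.alg n →⋆ₐ[ℂ] I.alg m :=
  Nat.leRec (motive := fun m _ => I.alg n →⋆ₐ[ℂ] I.alg m) (StarAlgHom.id ℂ (I.alg n))
    (fun k _ f => (I.step k).comp f) h

theorem towerIncl_self (n : ℕ) : I.towerIncl (le_refl n) = StarAlgHom.id ℂ (I.alg n) :=
  Nat.leRec_self ..

theorem towerIncl_succ {n m : ℕ} (h : n ≤ m) :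
    I.towerIncl (h.trans m.le_succ) = (I.step m).comp (I.towerIncl h) :=
  Nat.leRec_succ ..

/-- The inclusion `A = B_0 → B_n`. -/
noncomputable def baseIncl : (n : ℕ) → I.alg 0 →⋆ₐ[ℂ] I.alg n
  | 0 => StarAlgHom.id ℂ (I.alg 0)
  | n + 1 => (I.step n).comp (baseIncl n)

theorem baseIncl_eq (n : ℕ) : I.baseIncl n = I.towerIncl n.zero_le := by
  induction n with
  | zero => exact (I.towerIncl_self 0).symm
  | succ n ih => rw [baseIncl, ih]; exact (I.towerIncl_succ n.zero_le).symm

/-- The conditional expectation `E_1 ∘ E_2 ∘ ⋯ ∘ E_n : B_n → B_0`. -/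
noncomputable def baseExpectation : (n : ℕ) → FaithfulCondExp (I.baseIncl n)
  | 0 => FaithfulCondExp.refl (I.alg 0)
  | n + 1 => (baseExpectation n).comp (I.expectation n)

instance baseExpectation_isIndexFinite : (n : ℕ) → (I.baseExpectation n).IsIndexFinite
  | 0 => inferInstanceAs (FaithfulCondExp.refl (I.alg 0)).IsIndexFinite
  | n + 1 =>
    have := baseExpectation_isIndexFinite n
    inferInstanceAs ((I.baseExpectation n).comp (I.expectation n)).IsIndexFinite

end FiniteIndexInclusion

end CStarIndex

open CStarIndex

/-!
The proof finds in `B_{2n}` a projection `f_n` that plays the role of the Jones projection of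
`F = E_1 ∘ ⋯ ∘ E_n : B_n → A`, and recognizes `B_{2n}` as the basic construction by means of it.

*Recognition* (`FaithfulCondExp.IsJonesProj.exists_starAlgEquiv`). Let `C ⊇ B` be C⋆-algebras and
`f ∈ C` a projection with `f b f = E(b) f` for `b ∈ B`, such that `C f = B f`, that `C` acts
faithfully on the left ideal `C f`, and that `a f = 0` forces `a = 0` for `a ∈ A`. Then `C` acts on
`B f ≅ B` by right `A`-linear maps. In terms of a quasi-basis `u`, the inverse of this action is
`T ↦ ∑ T(uⱼ) f uⱼ⋆`, which is a ⋆-isomorphism from the basic construction onto `C` and is the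
identity on `B`.

*Constant index.* As `Index(E) ∈ A`, the dual expectation has the same index
(`FaithfulCondExp.index_dual`), so that one element of `A` is the index of every `E_k`, and it is
central in every `B_k` with `k ≥ 1`. Writing `λ` for its inverse, `E_{k+1}(e_k) = λ` gives the
relation `e_{k+1} e_k e_{k+1} = λ e_{k+1}`.

*The projection* (`JonesTower.IsIterated.succ`). Starting from `f_0 = 1`, put
`f_{n+1} = λ⁻ⁿ g f_n g⋆` with `g = e_{n+1} e_{n+2} ⋯ e_{2n+1}`. Since `g⋆ x g = λⁿ E_{n+1}(x) e_{2n+1}`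
for `x ∈ B_{n+1}` and `e_{2n+1}` commutes with `f_n ∈ B_{2n}`, the projection `f_{n+1}` implements
`E_1 ∘ ⋯ ∘ E_{n+1}`. The equality `B_{2n+2} f_{n+1} = B_{n+1} f_{n+1}` is obtained by pushing
elements of `B_{2n+1}` down through the factors of `g`, using `B_{k+1} = span B_k e_k B_k` and
`B_{2n} f_n = B_n f_n` (`JonesTower.IsIterated.exists_mul_chain_mul`).

The algebras `B_k` are different types, so these computations take place in the images of the `B_k`
in a fixed `B_N`; `JonesTower` collects what they need. There the projections are numbered from `0`:
`e k` is the Jones projection of `B_{k+1} → B_k`, denoted `e_{k+1}` above.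
-/

namespace CStarIndex

namespace FaithfulCondExp

/-! ### Algebra in the basic construction -/

section Relations

variable {A B : Type u} [CStarAlgebra A] [CStarAlgebra B] {ι : A →⋆ₐ[ℂ] B}
  (E : FaithfulCondExp ι) [E.IsIndexFinite]

theorem jonesProj_mul_self : E.jonesProj * E.jonesProj = E.jonesProj :=
  Subtype.ext E.jones_mul_self

theorem jonesProj_mul_incl_mul_jonesProj (b : B) :
    E.jonesProj * E.incl b * E.jonesProj = E.incl (ι (E b)) * E.jonesProj :=
  Subtype.ext (E.jones_lambda_jones b)

theorem jonesProj_mul_incl (a : A) :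
    E.jonesProj * E.incl (ι a) = E.incl (ι a) * E.jonesProj :=
  op_ext fun b => by
    rw [op_mul, op_mul, op_jonesProj, op_incl, op_incl, op_jonesProj, apply_incl_mul, map_mul]

theorem eq_zero_of_incl_mul_jonesProj {b : B} (h : E.incl b * E.jonesProj = 0) : b = 0 := by
  have h1 := congrArg (fun T => E.op T 1) h
  have h2 : E (1 : B) = 1 := by rw [← map_one ι, apply_incl]
  simp only [op_mul, op_incl, op_jonesProj, h2, map_one, mul_one] at h1
  exact h1

/-- The span of the elements `x e y` with `x, y ∈ B` is the whole basic construction. -/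
theorem sum_incl_mul_jonesProj_mul_incl (T : E.BasicConstruction) :
    ∑ j, E.incl (E.op T (E.qb j)) * E.jonesProj * E.incl (star (E.qb j)) = T :=
  op_ext fun b => by
    rw [op_sum]
    simp only [op_mul, op_incl, op_jonesProj]
    exact E.linear_expand (E.op T) (E.op_mul_incl T) b

theorem dual_jonesProj : E.dual E.jonesProj = Ring.inverse E.index := by
  have h := E.dual_apply 1 1
  simpa using h

theorem star_index : star E.index = E.index := by
  simp [index, star_sum]

/-- The elements `uⱼ e r`, with `r` a self-adjoint square root of the index, form a
quasi-basis of the dual expectation. -/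
theorem isQuasiBasis_dual {r : B} (hr : star r = r) (hrr : r * r = E.index) :
    E.dual.IsQuasiBasis fun j => E.incl (E.qb j) * E.jonesProj * E.incl r := by
  refine IsQuasiBasis.of_left _ fun T => ?_
  have hk : r * Ring.inverse E.index * r = 1 := by
    rw [E.inverse_comm, mul_assoc, hrr, Ring.inverse_mul_cancel _ (isUnit_index E)]
  -- by linearity the identity is only needed for `T = x e y`
  have key : ∀ x y : B, ∑ j, E.incl (E.qb j) * E.jonesProj * E.incl r *
      E.incl (E.dual (star (E.incl (E.qb j) * E.jonesProj * E.incl r) *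
        (E.incl x * E.jonesProj * E.incl y))) = E.incl x * E.jonesProj * E.incl y := by
    intro x y
    have h1 : ∀ j, star (E.incl (E.qb j) * E.jonesProj * E.incl r) *
        (E.incl x * E.jonesProj * E.incl y) =
        E.incl (r * ι (E (star (E.qb j) * x))) * E.jonesProj * E.incl y := fun j => by
      calc _ = E.incl r * (E.jonesProj * E.incl (star (E.qb j) * x) * E.jonesProj) *
            E.incl y := by
            rw [star_mul, star_mul, ← map_star, ← map_star, hr, star_jonesProj, map_mul E.incl]
            simp only [mul_assoc]
        _ = _ := by
            rw [jonesProj_mul_incl_mul_jonesProj, map_mul E.incl]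
            simp only [mul_assoc]
    have h2 : ∀ j, E.incl (E.qb j) * E.jonesProj * E.incl r *
        E.incl (Ring.inverse E.index * (r * ι (E (star (E.qb j) * x))) * y) =
        E.incl (E.qb j * ι (E (star (E.qb j) * x))) * (E.jonesProj * E.incl y) := fun j => by
      have h3 : r * (Ring.inverse E.index * (r * ι (E (star (E.qb j) * x))) * y) =
          ι (E (star (E.qb j) * x)) * y := by
        simp only [← mul_assoc]
        rw [hk, one_mul]
      rw [mul_assoc _ (E.incl r), ← map_mul E.incl, h3, map_mul E.incl, map_mul E.incl]
      simp only [← mul_assoc]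
      rw [mul_assoc _ E.jonesProj, jonesProj_mul_incl, ← mul_assoc]
    simp only [h1, dual_apply, h2]
    -- a term, since `rw` does not unify the ring structures on the basic construction
    refine (Finset.sum_mul _ _ _).symm.trans ?_
    rw [← map_sum, E.qb_left, mul_assoc]
  have add : ∀ (j : Fin E.qbCard) (S : Fin E.qbCard → E.BasicConstruction),
      E.incl (E.qb j) * E.jonesProj * E.incl r *
        E.incl (E.dual (star (E.incl (E.qb j) * E.jonesProj * E.incl r) * ∑ k, S k)) =
      ∑ k, E.incl (E.qb j) * E.jonesProj * E.incl r *
        E.incl (E.dual (star (E.incl (E.qb j) * E.jonesProj * E.incl r) * S k)) :=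
    fun j S => by
      refine (congrArg (fun z => E.incl (E.qb j) * E.jonesProj * E.incl r * E.incl (E.dual z))
        (Finset.mul_sum _ _ _)).trans ?_
      simp only [map_sum]
      exact Finset.mul_sum _ _ _
  rw [← E.sum_incl_mul_jonesProj_mul_incl T]
  refine (Finset.sum_congr rfl fun j _ => add j _).trans (Finset.sum_comm.trans ?_)
  exact Finset.sum_congr rfl fun k _ => key _ _

/-- If the index lies in the smaller algebra, passing to the dual expectation preserves it. -/
theorem index_dual {a : A} (ha : ι a = E.index) : E.dual.index = E.incl E.index := by
  obtain ⟨r, hr, hrr, -⟩ := exists_sqrt_index E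
  rw [E.dual.index_eq (E.isQuasiBasis_dual hr hrr)]
  have h : ∀ j, E.incl (E.qb j) * E.jonesProj * E.incl r *
      star (E.incl (E.qb j) * E.jonesProj * E.incl r) =
      E.incl E.index * (E.incl (E.qb j) * E.jonesProj * E.incl (star (E.qb j))) := fun j => by
    calc _ = E.incl (E.qb j) * (E.jonesProj * E.incl (r * r) * E.jonesProj) *
          E.incl (star (E.qb j)) := by
          rw [star_mul, star_mul, ← map_star, ← map_star, hr, star_jonesProj, map_mul]
          simp only [mul_assoc]
      _ = E.incl (E.qb j * E.index) * E.jonesProj * E.incl (star (E.qb j)) := by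
          rw [jonesProj_mul_incl_mul_jonesProj, hrr, ← ha, apply_incl, map_mul]
          simp only [mul_assoc]
      _ = _ := by
          rw [E.index_comm, map_mul]
          simp only [mul_assoc]
  simp only [h]
  refine (Finset.mul_sum _ _ _).symm.trans ?_
  exact (congrArg _ (E.sum_incl_mul_jonesProj_mul_incl 1)).trans (mul_one _)

end Relations

/-! ### Recognizing the basic construction by a projection -/

section Recognition

variable {A B C : Type u} [CStarAlgebra A] [CStarAlgebra B] [CStarAlgebra C] {ι : A →⋆ₐ[ℂ] B}
  (E : FaithfulCondExp ι)

/-- `f` plays in `C ⊇ B` the role of the Jones projection of `E : B → A`: it implements `E`, the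
algebra `A` acts faithfully on it, and the left ideal `C f` is `B f` and is a faithful `C`-module. -/
structure IsJonesProj (κ : B →⋆ₐ[ℂ] C) (f : C) : Prop where
  star_eq : star f = f
  mul_self : f * f = f
  implements : ∀ b, f * κ b * f = κ (ι (E b)) * f
  cancel : ∀ a, κ (ι a) * f = 0 → a = 0
  reduce : ∀ c, ∃ b, c * f = κ b * f
  faithful : ∀ c, (∀ x, c * x * f = 0) → c = 0

variable {E} [E.IsIndexFinite] {κ : B →⋆ₐ[ℂ] C} {f : C}

namespace IsJonesProj

variable (hf : E.IsJonesProj κ f)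

include hf

omit [E.IsIndexFinite] in
theorem commute_incl (a : A) : f * κ (ι a) = κ (ι a) * f := by
  have h1 : ∀ a, f * κ (ι a) * f = κ (ι a) * f := fun a => by
    rw [hf.implements, E.apply_incl]
  have h2 := congrArg star (h1 (star a))
  simp only [star_mul, hf.star_eq, ← map_star, star_star] at h2
  rw [← h2, ← mul_assoc, h1]

omit hf in
variable (E κ f) in
/-- The map `T ↦ ∑ T(uⱼ) f uⱼ⋆` from the basic construction to `C`. -/
noncomputable def toFun (T : E.BasicConstruction) : C :=
  ∑ j, κ (E.op T (E.qb j)) * f * κ (star (E.qb j))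

/-- Under `B f ≅ B`, the image of `T` acts as `T`. -/
theorem toFun_mul (T : E.BasicConstruction) (b : B) :
    toFun E κ f T * (κ b * f) = κ (E.op T b) * f := by
  have h : ∀ j, κ (E.op T (E.qb j)) * f * κ (star (E.qb j)) * (κ b * f) =
      κ (E.op T (E.qb j) * ι (E (star (E.qb j) * b))) * f := fun j => by
    calc _ = κ (E.op T (E.qb j)) * (f * κ (star (E.qb j) * b) * f) := by
          rw [map_mul]; simp only [mul_assoc]
      _ = _ := by rw [hf.implements, map_mul κ (_ : B) (ι _), mul_assoc]
  rw [toFun, Finset.sum_mul]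
  simp only [h]
  rw [← Finset.sum_mul, ← map_sum, E.linear_expand (E.op T) (E.op_mul_incl T)]

omit [E.IsIndexFinite] in
/-- Elements of `C` are determined by their action on `B f`. -/
theorem ext_mul {c d : C} (h : ∀ b, c * (κ b * f) = d * (κ b * f)) : c = d := by
  refine sub_eq_zero.mp (hf.faithful _ fun x => ?_)
  obtain ⟨b, hb⟩ := hf.reduce x
  rw [mul_assoc, hb, sub_mul, h, sub_self]

omit [E.IsIndexFinite] in
theorem eq_zero_of_mul {b : B} (h : κ b * f = 0) : b = 0 := by
  refine E.faithful b (hf.cancel _ ?_)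
  rw [show E.toFun (star b * b) = E (star b * b) from rfl, ← hf.implements, map_mul, mul_assoc,
    mul_assoc, h, mul_zero, mul_zero]

theorem toFun_star (T : E.BasicConstruction) : toFun E κ f (star T) = star (toFun E κ f T) := by
  have h1 : ∀ k, κ (E.op (star T) (E.qb k)) * f * κ (star (E.qb k)) =
      ∑ j, κ (E.qb j) * f * κ (ι (E (star (E.op T (E.qb j)) * E.qb k)) * star (E.qb k)) :=
    fun k => by
      rw [← E.qb_left (E.op (star T) (E.qb k)), map_sum, Finset.sum_mul, Finset.sum_mul]
      refine Finset.sum_congr rfl fun j _ => ?_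
      rw [E.op_star, map_mul κ, map_mul κ, mul_assoc (κ (E.qb j)), ← hf.commute_incl]
      simp only [mul_assoc]
  simp only [toFun, h1]
  rw [Finset.sum_comm, star_sum]
  refine Finset.sum_congr rfl fun j _ => ?_
  rw [← Finset.mul_sum, ← map_sum, E.qb_right, star_mul, star_mul, hf.star_eq, ← map_star κ,
    ← map_star κ, star_star, mul_assoc]

theorem toFun_incl (b : B) : toFun E κ f (E.incl b) = κ b :=
  hf.ext_mul fun x => by
    rw [hf.toFun_mul, op_incl, map_mul, mul_assoc]

/-- The preimage of `c` is the operator by which `c` acts on `B f ≅ B`, expanded in the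
quasi-basis. -/
theorem toFun_surjective (c : C) : ∃ T, toFun E κ f T = c := by
  choose g hg using fun j => hf.reduce (c * κ (E.qb j))
  refine ⟨∑ j, E.incl (g j) * E.jonesProj * E.incl (star (E.qb j)), ?_⟩
  refine hf.ext_mul fun b => ?_
  rw [hf.toFun_mul]
  simp only [op_sum, op_mul, op_incl, op_jonesProj]
  conv_rhs => rw [← E.qb_left b]
  simp only [map_sum, map_mul, Finset.sum_mul, Finset.mul_sum]
  refine Finset.sum_congr rfl fun j _ => ?_
  rw [mul_assoc, ← hf.commute_incl, ← mul_assoc, ← hg, mul_assoc, hf.commute_incl]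
  simp only [mul_assoc]

/-- A unital inclusion `B ⊆ C` with a projection in the role of the Jones projection of `E` is
isomorphic to the basic construction for `E`. -/
theorem exists_starAlgEquiv :
    ∃ Φ : E.BasicConstruction ≃⋆ₐ[ℂ] C, ∀ b, Φ (E.incl b) = κ b := by
  let Ψ : E.BasicConstruction →⋆ₐ[ℂ] C :=
    { toFun := toFun E κ f
      map_one' := by rw [← map_one E.incl, hf.toFun_incl, map_one]
      map_zero' := by rw [← map_zero E.incl, hf.toFun_incl, map_zero]
      map_add' := fun S T => by
        simp only [toFun, op_add, map_add, add_mul, Finset.sum_add_distrib]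
      map_mul' := fun S T => hf.ext_mul fun b => by
        rw [mul_assoc, hf.toFun_mul, hf.toFun_mul, hf.toFun_mul, op_mul]
      commutes' := fun c => by
        have h : algebraMap ℂ E.BasicConstruction c = E.incl (algebraMap ℂ B c) :=
          (E.incl.toAlgHom.commutes c).symm
        rw [h, hf.toFun_incl]
        exact κ.toAlgHom.commutes c
      map_star' := hf.toFun_star }
  have hΨ : Function.Bijective Ψ := by
    refine ⟨(injective_iff_map_eq_zero Ψ).mpr fun T hT => op_ext fun b => ?_,
      hf.toFun_surjective⟩
    refine hf.eq_zero_of_mul ?_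
    rw [← hf.toFun_mul T b, show toFun E κ f T = 0 from hT, zero_mul]
  exact ⟨StarAlgEquiv.ofBijective Ψ hΨ, hf.toFun_incl⟩

end IsJonesProj

end Recognition

end FaithfulCondExp

/-! ### Towers of projections in a fixed algebra -/

/-- The part of a tower of basic constructions `S 0 ⊆ S 1 ⊆ ⋯ ⊆ S N` that lives inside one ambient
algebra `D`: the projection `e k ∈ S (k + 2)` implements the expectation `ex k : S (k + 1) → S k`,
and `S (k + 2)` is spanned by `S (k + 1) (e k) S (k + 1)`. The index `ind` is a central unit with
inverse `lam`, the same at each stage. Only `k ≤ N` matters: `S`, `e` and `ex` are arbitrary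
outside that range. -/
structure JonesTower (D : Type u) [Ring D] [StarRing D] [Algebra ℂ D] [StarModule ℂ D]
    (N : ℕ) where
  S : ℕ → StarSubalgebra ℂ D
  mono : ∀ {j k}, j ≤ k → k ≤ N → S j ≤ S k
  e : ℕ → D
  ex : ℕ → D → D
  lam : D
  ind : D
  ind_mem : ind ∈ S 0
  lam_comm : ∀ x, lam * x = x * lam
  ind_comm : ∀ x, ind * x = x * ind
  star_ind : star ind = ind
  ind_mul_lam : ind * lam = 1
  star_e : ∀ {k}, k + 2 ≤ N → star (e k) = e k
  e_mem : ∀ {k}, k + 2 ≤ N → e k ∈ S (k + 2)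
  e_mul_e : ∀ {k}, k + 2 ≤ N → e k * e k = e k
  e_comm : ∀ {k x}, k + 2 ≤ N → x ∈ S k → e k * x = x * e k
  ex_mem : ∀ {k x}, k + 2 ≤ N → x ∈ S (k + 1) → ex k x ∈ S k
  e_mul_mul_e : ∀ {k x}, k + 2 ≤ N → x ∈ S (k + 1) → e k * x * e k = ex k x * e k
  eq_sum : ∀ {k y}, k + 2 ≤ N → y ∈ S (k + 2) → ∃ (m : ℕ) (s t : Fin m → D),
    (∀ i, s i ∈ S (k + 1)) ∧ (∀ i, t i ∈ S (k + 1)) ∧ y = ∑ i, s i * e k * t i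
  cancel : ∀ {k x}, k + 2 ≤ N → x ∈ S (k + 1) → x * e k = 0 → x = 0
  e_e_e : ∀ {k}, k + 3 ≤ N → e (k + 1) * e k * e (k + 1) = lam * e (k + 1)

namespace JonesTower

variable {D : Type u} [Ring D] [StarRing D] [Algebra ℂ D] [StarModule ℂ D] {N : ℕ}
  (𝒯 : JonesTower D N)

/-- The descending composition `ex 0 ∘ ex 1 ∘ ⋯ ∘ ex (n - 1)`, from `S n` to `S 0`. -/
def exBase : ℕ → D → D
  | 0, x => x
  | n + 1, x => exBase n (𝒯.ex n x)

variable {𝒯} in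
theorem exBase_mem {n : ℕ} (hn : n + 1 ≤ N) {x : D} (hx : x ∈ 𝒯.S n) :
    𝒯.exBase n x ∈ 𝒯.S 0 := by
  induction n generalizing x with
  | zero => exact hx
  | succ n ih => exact ih (by omega) (𝒯.ex_mem hn hx)

theorem exists_mul_e_eq {k : ℕ} (hk : k + 2 ≤ N) {y : D} (hy : y ∈ 𝒯.S (k + 2)) :
    ∃ x ∈ 𝒯.S (k + 1), y * 𝒯.e k = x * 𝒯.e k := by
  obtain ⟨m, s, t, hs, ht, rfl⟩ := 𝒯.eq_sum hk hy
  refine ⟨∑ i, s i * 𝒯.ex k (t i), sum_mem fun i _ =>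
    mul_mem (hs i) (𝒯.mono (by omega) (by omega) (𝒯.ex_mem hk (ht i))), ?_⟩
  rw [Finset.sum_mul, Finset.sum_mul]
  refine Finset.sum_congr rfl fun i _ => ?_
  rw [mul_assoc (s i), mul_assoc (s i), 𝒯.e_mul_mul_e hk (ht i), mul_assoc]

theorem eq_zero_of_mul_e {k : ℕ} (hk : k + 2 ≤ N) {d : D}
    (h : ∀ y ∈ 𝒯.S (k + 2), d * y * 𝒯.e k = 0) : d = 0 := by
  obtain ⟨m, s, t, hs, ht, h1⟩ := 𝒯.eq_sum hk (one_mem (𝒯.S (k + 2)))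
  rw [← mul_one d, h1, Finset.mul_sum]
  refine Finset.sum_eq_zero fun i _ => ?_
  rw [← mul_assoc, ← mul_assoc, h _ (𝒯.mono (by omega) hk (hs i)), zero_mul]

/-- The product `e a * e (a + 1) * ⋯ * e (a + l)`. -/
def chain : ℕ → ℕ → D
  | a, 0 => 𝒯.e a
  | a, l + 1 => 𝒯.e a * chain (a + 1) l

theorem chain_mem {a l : ℕ} (h : a + l + 2 ≤ N) : 𝒯.chain a l ∈ 𝒯.S (a + l + 2) := by
  induction l generalizing a with
  | zero => exact 𝒯.e_mem h
  | succ l ih =>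
    refine mul_mem (𝒯.mono (by omega) h (𝒯.e_mem (by omega))) ?_
    have := ih (a := a + 1) (by omega)
    rwa [show a + (l + 1) + 2 = a + 1 + l + 2 by omega]

theorem chain_comm {a l : ℕ} (h : a + l + 2 ≤ N) {x : D} (hx : x ∈ 𝒯.S a) :
    𝒯.chain a l * x = x * 𝒯.chain a l := by
  induction l generalizing a with
  | zero => exact 𝒯.e_comm h hx
  | succ l ih =>
    rw [chain, mul_assoc, ih (by omega) (𝒯.mono (by omega) (by omega) hx), ← mul_assoc,
      𝒯.e_comm (by omega) hx, mul_assoc]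

theorem e_mul_chain {a l : ℕ} (h : a + l + 2 ≤ N) : 𝒯.e a * 𝒯.chain a l = 𝒯.chain a l := by
  cases l with
  | zero => exact 𝒯.e_mul_e h
  | succ l => rw [chain, ← mul_assoc, 𝒯.e_mul_e (by omega)]

theorem chain_mul_e {a l : ℕ} (h : a + l + 2 ≤ N) :
    𝒯.chain a l * 𝒯.e (a + l) = 𝒯.chain a l := by
  induction l generalizing a with
  | zero => exact 𝒯.e_mul_e h
  | succ l ih =>
    rw [chain, mul_assoc, show a + (l + 1) = a + 1 + l by omega, ih (by omega)]

theorem star_chain_mul_chain {a l : ℕ} (h : a + l + 2 ≤ N) :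
    star (𝒯.chain a l) * 𝒯.chain a l = 𝒯.lam ^ l * 𝒯.e (a + l) := by
  induction l generalizing a with
  | zero => rw [chain, 𝒯.star_e h, 𝒯.e_mul_e h, pow_zero, one_mul, add_zero]
  | succ l ih =>
    have h1 := 𝒯.e_mul_chain (a := a + 1) (l := l) (by omega)
    have h2 := congrArg star h1
    rw [star_mul, 𝒯.star_e (by omega)] at h2
    calc star (𝒯.chain a (l + 1)) * 𝒯.chain a (l + 1)
        = star (𝒯.chain (a + 1) l) * (𝒯.e a * 𝒯.e a) * 𝒯.chain (a + 1) l := by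
          rw [chain, star_mul, 𝒯.star_e (by omega)]; simp only [mul_assoc]
      _ = star (𝒯.chain (a + 1) l) * (𝒯.e (a + 1) * 𝒯.e a * 𝒯.e (a + 1)) *
            𝒯.chain (a + 1) l := by
          rw [𝒯.e_mul_e (by omega)]
          simp only [mul_assoc]
          rw [h1, ← mul_assoc (star _) (𝒯.e (a + 1)), h2]
      _ = 𝒯.lam * (star (𝒯.chain (a + 1) l) * 𝒯.chain (a + 1) l) := by
          rw [𝒯.e_e_e (by omega), ← mul_assoc _ 𝒯.lam, ← 𝒯.lam_comm, mul_assoc 𝒯.lam, h2,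
            mul_assoc]
      _ = _ := by
          rw [ih (by omega), ← mul_assoc, ← pow_succ', show a + (l + 1) = a + 1 + l by omega]

theorem star_chain_mul_mul_chain {a l : ℕ} (h : a + l + 2 ≤ N) {x : D} (hx : x ∈ 𝒯.S (a + 1)) :
    star (𝒯.chain a l) * x * 𝒯.chain a l = 𝒯.lam ^ l * 𝒯.ex a x * 𝒯.e (a + l) := by
  have h1 := 𝒯.e_mul_chain h
  have h2 := congrArg star h1
  rw [star_mul, 𝒯.star_e (by omega)] at h2
  have h3 := congrArg star (𝒯.chain_comm h (star_mem (𝒯.ex_mem (by omega) hx)))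
  rw [star_mul, star_mul, star_star] at h3
  calc _ = star (𝒯.chain a l) * (𝒯.e a * x * 𝒯.e a) * 𝒯.chain a l := by
        simp only [mul_assoc]
        rw [h1, ← mul_assoc (star _) (𝒯.e a), h2]
    _ = star (𝒯.chain a l) * 𝒯.ex a x * 𝒯.chain a l := by
        rw [𝒯.e_mul_mul_e (by omega) hx]
        simp only [mul_assoc]
        rw [h1]
    _ = 𝒯.ex a x * (𝒯.lam ^ l * 𝒯.e (a + l)) := by
        rw [← h3, mul_assoc, 𝒯.star_chain_mul_chain h]
    _ = _ := by
        rw [← mul_assoc, ((show Commute 𝒯.lam _ from 𝒯.lam_comm (𝒯.ex a x)).pow_left l).eq]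

/-- The projection `f ∈ S (2 * n)` implements the composed expectation `S n → S 0` and is full:
this is what distinguishes `S (2 * n)` as the basic construction for `S 0 ⊆ S n`. -/
structure IsIterated (n : ℕ) (f : D) : Prop where
  mem : f ∈ 𝒯.S (2 * n)
  star_eq : star f = f
  mul_self : f * f = f
  implements : ∀ x ∈ 𝒯.S n, f * x * f = 𝒯.exBase n x * f
  comm : ∀ a ∈ 𝒯.S 0, f * a = a * f
  cancel : ∀ a ∈ 𝒯.S 0, a * f = 0 → a = 0
  reduce : ∀ c ∈ 𝒯.S (2 * n), ∃ x ∈ 𝒯.S n, c * f = x * f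
  -- the left factor ranges over the ambient algebra, which the induction on `n` needs
  faithful : ∀ d, (∀ x ∈ 𝒯.S (2 * n), d * x * f = 0) → d = 0

variable {𝒯} in
/-- Elements of `S (2 * n + 1)` can be pushed down to `S (n + 1)` in front of
`e n * ⋯ * e (2 * n) * f`; `l + 1` is the number of factors already collected. -/
theorem IsIterated.exists_mul_chain_mul {n : ℕ} {f : D} (hf : 𝒯.IsIterated n f)
    (hN : 2 * n + 2 ≤ N) {l a : ℕ} (hl : a + l = 2 * n) (ha : n ≤ a) {x : D}
    (hx : x ∈ 𝒯.S (2 * n + 1)) :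
    ∃ y ∈ 𝒯.S (a + 1), x * 𝒯.e (2 * n) * f = y * 𝒯.chain a l * f := by
  induction l generalizing a with
  | zero =>
    obtain rfl : a = 2 * n := hl
    exact ⟨x, hx, rfl⟩
  | succ l ih =>
    obtain ⟨y, hy, hxy⟩ := ih (a := a + 1) (by omega) (by omega)
    obtain ⟨m, s, t, hs, ht, rfl⟩ := 𝒯.eq_sum (by omega) hy
    choose t' ht' htt' using fun i =>
      hf.reduce (t i) (𝒯.mono (by omega) (by omega) (ht i))
    refine ⟨∑ i, s i * t' i, sum_mem fun i _ =>
      mul_mem (hs i) (𝒯.mono (by omega) (by omega) (ht' i)), ?_⟩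
    rw [hxy, Finset.sum_mul, Finset.sum_mul, Finset.sum_mul, Finset.sum_mul]
    refine Finset.sum_congr rfl fun i _ => ?_
    -- `t i` moves past the chain, is reduced by `f` to an element of `S n`, and moves back
    calc s i * 𝒯.e a * t i * 𝒯.chain (a + 1) l * f
        = s i * 𝒯.e a * (𝒯.chain (a + 1) l * (t i * f)) := by
          rw [← mul_assoc (𝒯.chain (a + 1) l), 𝒯.chain_comm (by omega) (ht i)]
          simp only [mul_assoc]
      _ = s i * (𝒯.e a * t' i) * 𝒯.chain (a + 1) l * f := by
          rw [htt', ← mul_assoc (𝒯.chain (a + 1) l),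
            𝒯.chain_comm (by omega) (𝒯.mono (by omega) (by omega) (ht' i))]
          simp only [mul_assoc]
      _ = s i * t' i * 𝒯.chain a (l + 1) * f := by
          rw [𝒯.e_comm (by omega) (𝒯.mono (by omega) (by omega) (ht' i)), chain]
          simp only [mul_assoc]

theorem isIterated_zero : 𝒯.IsIterated 0 1 where
  mem := one_mem _
  star_eq := star_one _
  mul_self := one_mul 1
  implements x _ := by simp [exBase]
  comm a _ := by simp
  cancel a _ h := by simpa using h
  reduce c hc := ⟨c, hc, rfl⟩
  faithful d h := by simpa using h 1 (one_mem _)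

theorem lam_pow_mul_ind_pow (n : ℕ) : 𝒯.lam ^ n * 𝒯.ind ^ n = 1 := by
  have h : Commute 𝒯.lam 𝒯.ind := 𝒯.lam_comm _
  rw [← h.mul_pow, h.eq, 𝒯.ind_mul_lam, one_pow]

variable {𝒯} in
/-- The inductive step: `ind ^ n * g * f * star g` with `g = e n * e (n + 1) * ⋯ * e (2 * n)`.
In terms of Temperley–Lieb diagrams, `f` consists of `n` nested caps and cups, and `g` inserts a
further cap in their centre. -/
theorem IsIterated.succ {n : ℕ} {f : D} (hf : 𝒯.IsIterated n f) (hN : 2 * n + 2 ≤ N) :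
    𝒯.IsIterated (n + 1) (𝒯.ind ^ n * (𝒯.chain n n * f * star (𝒯.chain n n))) := by
  have hnn : n + n + 2 ≤ N := by omega
  have h2n : 2 * (n + 1) = 2 * n + 2 := by ring
  have hnn2 : n + n = 2 * n := by omega
  set g := 𝒯.chain n n with hg
  set e := 𝒯.e (2 * n) with he
  have hef : e * f = f * e := 𝒯.e_comm (by omega) hf.mem
  have hge : g * e = g := by
    have := 𝒯.chain_mul_e hnn
    rwa [hnn2] at this
  have hgg : star g * g = 𝒯.lam ^ n * e := by
    have := 𝒯.star_chain_mul_chain hnn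
    rwa [hnn2] at this
  have hgxg : ∀ x ∈ 𝒯.S (n + 1), star g * x * g = 𝒯.lam ^ n * 𝒯.ex n x * e := fun x hx => by
    have := 𝒯.star_chain_mul_mul_chain hnn hx
    rwa [hnn2] at this
  have hgm : g ∈ 𝒯.S (2 * n + 2) := by
    have := 𝒯.chain_mem hnn
    rwa [hnn2] at this
  have hfm : f ∈ 𝒯.S (2 * n + 2) := 𝒯.mono (by omega) hN hf.mem
  have hind : 𝒯.ind ^ n ∈ 𝒯.S (2 * n + 2) :=
    𝒯.mono (by omega) hN (pow_mem 𝒯.ind_mem n)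
  have hg0 : ∀ a ∈ 𝒯.S 0, g * a = a * g := fun a ha =>
    𝒯.chain_comm hnn (𝒯.mono (by omega) (by omega) ha)
  have hg0' : ∀ a ∈ 𝒯.S 0, star g * a = a * star g := fun a ha => by
    have := congrArg star (hg0 (star a) (star_mem ha))
    rw [star_mul, star_mul, star_star] at this
    exact this.symm
  have hLc := 𝒯.lam_pow_mul_ind_pow n
  have hcm : ∀ x, x * 𝒯.ind ^ n = 𝒯.ind ^ n * x := fun x =>
    ((show Commute 𝒯.ind _ from 𝒯.ind_comm x).pow_left n).eq.symm
  have hLm : ∀ x, x * 𝒯.lam ^ n = 𝒯.lam ^ n * x := fun x =>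
    ((show Commute 𝒯.lam _ from 𝒯.lam_comm x).pow_left n).eq.symm
  have hLm' : ∀ x y, x * (𝒯.lam ^ n * y) = 𝒯.lam ^ n * (x * y) := fun x y => by
    rw [← mul_assoc, hLm, mul_assoc]
  have hsc : star (𝒯.ind ^ n) = 𝒯.ind ^ n := by rw [star_pow, 𝒯.star_ind]
  set c := 𝒯.ind ^ n with hc
  set L := 𝒯.lam ^ n with hL
  have hcL : c * L = 1 := by rw [← hcm, hLc]
  have hL0 : ∀ d : D, L * d = 0 → d = 0 := fun d hd => by
    rw [← one_mul d, ← hcL, mul_assoc, hd, mul_zero]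
  have hgfg : star g * (g * f) = L * (f * e) := by
    rw [← mul_assoc, hgg, mul_assoc, hef]
  have hgfe : g * (f * e) = g * f := by rw [← hef, ← mul_assoc, hge]
  set q := g * f * star g with hq
  have hqg : q * g = L * (g * f) := by
    rw [hq, mul_assoc, hgg, ← mul_assoc, hLm, mul_assoc, mul_assoc, hgfe]
  have hqq : q * q = L * q := by
    calc q * q = q * g * (f * star g) := by rw [hq]; simp only [mul_assoc]
      _ = L * (g * (f * f) * star g) := by rw [hqg]; simp only [mul_assoc]
      _ = L * q := by rw [hf.mul_self]
  have hqa : ∀ a ∈ 𝒯.S 0, q * a = a * q := fun a ha => by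
    calc q * a = g * (f * (star g * a)) := by rw [hq]; simp only [mul_assoc]
      _ = g * a * (f * star g) := by
          rw [hg0' a ha, ← mul_assoc f, hf.comm a ha]; simp only [mul_assoc]
      _ = a * q := by rw [hg0 a ha, hq]; simp only [mul_assoc]
  have himp : ∀ x ∈ 𝒯.S (n + 1), q * x * q = L * (𝒯.exBase (n + 1) x * q) := fun x hx => by
    have hy := 𝒯.ex_mem (by omega) hx
    have hz : 𝒯.exBase (n + 1) x ∈ 𝒯.S 0 := exBase_mem (n := n) (by omega) hy
    calc q * x * q = g * f * (star g * x * g) * f * star g := by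
          rw [hq]; simp only [mul_assoc]
      _ = g * f * (L * 𝒯.ex n x * e) * f * star g := by rw [hgxg x hx]
      _ = L * (g * (f * 𝒯.ex n x * (e * f)) * star g) := by
          rw [mul_assoc L, ← mul_assoc _ L, hLm]
          simp only [mul_assoc]
      _ = L * (g * (𝒯.exBase (n + 1) x * (f * e)) * star g) := by
          rw [hef, ← mul_assoc (f * _), hf.implements _ hy, mul_assoc _ f e, exBase]
      _ = L * (𝒯.exBase (n + 1) x * q) := by
          rw [← mul_assoc g, hg0 _ hz, mul_assoc _ g, hgfe, mul_assoc _ (g * f)]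
  have hcc : ∀ u v : D, c * u * (c * v) = c * (c * (u * v)) := fun u v => by
    rw [mul_assoc, ← mul_assoc u, hcm, mul_assoc c u]
  refine ⟨?_, ?_, ?_, fun x hx => ?_, fun a ha => ?_, fun a ha h => ?_, fun d hd => ?_,
    fun d h => ?_⟩
  · rw [h2n]
    exact mul_mem hind (mul_mem (mul_mem hgm hfm) (star_mem hgm))
  · rw [star_mul, hsc, hcm, hq, star_mul, star_mul, star_star, hf.star_eq, mul_assoc]
  · rw [hcc, hqq, ← mul_assoc c L, hcL, one_mul]
  · rw [mul_assoc c, hcc, himp x hx, ← mul_assoc c L, hcL, one_mul, ← mul_assoc, ← hcm,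
      mul_assoc]
  · rw [mul_assoc, hqa a ha, ← mul_assoc, ← hcm, mul_assoc]
  · have h1 : L * (L * (a * f * e)) = 0 := by
      calc _ = L * (star g * (a * (g * f))) := by
            rw [← mul_assoc (star g) a, hg0' a ha, mul_assoc a (star g), hgfg, hLm' a,
              mul_assoc a f]
        _ = star g * (a * (q * g)) := by
            rw [hqg, hLm', hLm']
        _ = star g * (L * (a * (c * q)) * g) := by
            rw [← mul_assoc a c, hcm, mul_assoc c a, ← mul_assoc L c, hLc, one_mul]
            simp only [mul_assoc]
        _ = 0 := by rw [h, mul_zero, zero_mul, mul_zero]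
    have h2 := 𝒯.cancel hN (𝒯.mono (by omega) (by omega) (mul_mem
      (𝒯.mono (Nat.zero_le _) (by omega) ha) hf.mem)) (hL0 _ (hL0 _ h1))
    exact hf.cancel a ha h2
  · rw [h2n] at hd
    obtain ⟨y, hy, hdy⟩ := 𝒯.exists_mul_e_eq hN (mul_mem hd hgm)
    obtain ⟨z, hz, hyz⟩ := hf.exists_mul_chain_mul hN (l := n) (a := n) (by omega) le_rfl hy
    refine ⟨z, hz, ?_⟩
    have h1 : d * g * f = z * g * f := by
      rw [← hg, ← he] at hyz
      rw [← hyz, ← hdy, ← he, mul_assoc d g e, hge]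
    calc d * (c * q) = c * (d * g * f * star g) := by
          rw [← mul_assoc, hcm, hq]; simp only [mul_assoc]
      _ = z * (c * q) := by
          rw [h1, ← mul_assoc z, hcm, hq]; simp only [mul_assoc]
  · rw [h2n] at h
    -- the hypothesis for `x * star g` says that `f * e` is killed
    have h1 : ∀ x ∈ 𝒯.S (2 * n + 2), d * x * (f * e) = 0 := fun x hx => by
      have h2 := h (x * star g) (mul_mem hx (star_mem hgm))
      refine hL0 _ (hL0 _ ?_)
      calc L * (L * (d * x * (f * e))) = d * x * (L * (L * (f * e))) := by
            rw [hLm' (d * x), hLm' (d * x)]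
        _ = d * x * (star g * (q * g)) := by
            rw [hqg, ← hgfg, hLm' (star g)]
        _ = L * (d * (x * star g) * (c * q)) * g := by
            rw [← mul_assoc _ c, hcm, mul_assoc c, ← mul_assoc L, hLc, one_mul]
            simp only [mul_assoc]
        _ = 0 := by rw [h2, mul_zero, zero_mul]
    refine 𝒯.eq_zero_of_mul_e hN fun y hy => hf.faithful _ fun x hx => ?_
    rw [← h1 (y * x) (mul_mem hy (𝒯.mono (by omega) hN hx)), ← hef, mul_assoc _ e x,
      𝒯.e_comm hN hx]
    simp only [mul_assoc]
    rw [hef]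

theorem exists_isIterated {n : ℕ} (h : 2 * n ≤ N) : ∃ f, 𝒯.IsIterated n f := by
  induction n with
  | zero => exact ⟨1, 𝒯.isIterated_zero⟩
  | succ n ih =>
    obtain ⟨f, hf⟩ := ih (by omega)
    exact ⟨_, hf.succ (by omega)⟩

end JonesTower

/-! ### The tower of basic constructions inside one of its algebras -/

namespace FiniteIndexInclusion

variable (I : FiniteIndexInclusion.{u})

theorem towerIncl_step {k m : ℕ} (h : k + 1 ≤ m) (x : I.alg k) :
    I.towerIncl h (I.step k x) = I.towerIncl (k.le_succ.trans h) x := by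
  induction m, h using Nat.le_induction with
  | base => rw [towerIncl_self, I.towerIncl_succ le_rfl, towerIncl_self]; rfl
  | succ m h ih =>
    rw [I.towerIncl_succ h, I.towerIncl_succ (k.le_succ.trans h)]
    exact congrArg (I.step m) ih

theorem towerIncl_injective {k m : ℕ} (h : k ≤ m) : Function.Injective (I.towerIncl h) := by
  induction m, h using Nat.le_induction with
  | base => rw [towerIncl_self]; exact fun _ _ h => h
  | succ m h ih =>
    rw [I.towerIncl_succ h]
    exact (I.expectation m).injective.comp ih

theorem towerIncl_towerIncl {j k m : ℕ} (hjk : j ≤ k) (hkm : k ≤ m) (x : I.alg j) :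
    I.towerIncl hkm (I.towerIncl hjk x) = I.towerIncl (hjk.trans hkm) x := by
  induction k, hjk using Nat.le_induction with
  | base => rw [towerIncl_self]; rfl
  | succ k hjk ih =>
    rw [I.towerIncl_succ hjk]
    exact (I.towerIncl_step hkm _).trans (ih _)

theorem baseIncl_succ_apply (n : ℕ) (a : I.alg 0) :
    I.baseIncl (n + 1) a = I.step n (I.baseIncl n a) := rfl

/-- The Jones projection of `B_{k+1} → B_k`, as an element of `B_{k+2}`. -/
noncomputable def proj (k : ℕ) : I.alg (k + 2) := (I.expectation k).jonesProj

theorem star_proj (k : ℕ) : star (I.proj k) = I.proj k := (I.expectation k).star_jonesProj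

theorem proj_mul_proj (k : ℕ) : I.proj k * I.proj k = I.proj k :=
  (I.expectation k).jonesProj_mul_self

theorem proj_mul_step_mul_proj (k : ℕ) (x : I.alg (k + 1)) :
    I.proj k * I.step (k + 1) x * I.proj k =
      I.step (k + 1) (I.step k (I.expectation k x)) * I.proj k :=
  (I.expectation k).jonesProj_mul_incl_mul_jonesProj x

theorem proj_mul_step_step (k : ℕ) (a : I.alg k) :
    I.proj k * I.step (k + 1) (I.step k a) = I.step (k + 1) (I.step k a) * I.proj k :=
  (I.expectation k).jonesProj_mul_incl a

theorem eq_zero_of_step_mul_proj (k : ℕ) {x : I.alg (k + 1)}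
    (h : I.step (k + 1) x * I.proj k = 0) : x = 0 :=
  (I.expectation k).eq_zero_of_incl_mul_jonesProj h

theorem exists_eq_sum_proj (k : ℕ) (y : I.alg (k + 2)) :
    ∃ (m : ℕ) (s t : Fin m → I.alg (k + 1)),
      y = ∑ i, I.step (k + 1) (s i) * I.proj k * I.step (k + 1) (t i) :=
  ⟨_, _, _, ((I.expectation k).sum_incl_mul_jonesProj_mul_incl y).symm⟩

theorem expectation_proj (k : ℕ) :
    I.expectation (k + 1) (I.proj k) = Ring.inverse (I.expectation k).index :=
  (I.expectation k).dual_jonesProj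

/-- An index in `B_0` is the index of every expectation of the tower. -/
theorem index_expectation {a : I.alg 0} (ha : I.step 0 a = (I.expectation 0).index) (k : ℕ) :
    (I.expectation k).index = I.baseIncl (k + 1) a := by
  induction k with
  | zero => exact ha.symm
  | succ k ih =>
    exact ((I.expectation k).index_dual (a := I.baseIncl k a) ih.symm).trans
      (congrArg (I.step (k + 1)) ih)

theorem towerIncl_baseIncl {n m : ℕ} (h : n ≤ m) (a : I.alg 0) :
    I.towerIncl h (I.baseIncl n a) = I.baseIncl m a := by
  rw [baseIncl_eq, baseIncl_eq, towerIncl_towerIncl]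

/-- The image of `B_k` in `B_N`, for `k ≤ N`; all of `B_N` otherwise. -/
noncomputable def image (N k : ℕ) : StarSubalgebra ℂ (I.alg N) :=
  if h : k ≤ N then (I.towerIncl h).range else ⊤

theorem mem_image {N k : ℕ} (h : k ≤ N) {d : I.alg N} :
    d ∈ I.image N k ↔ ∃ x, I.towerIncl h x = d := by
  rw [image, dif_pos h]
  exact Iff.rfl

theorem towerIncl_mem_image {N k : ℕ} (h : k ≤ N) (x : I.alg k) :
    I.towerIncl h x ∈ I.image N k := (I.mem_image h).mpr ⟨x, rfl⟩

/-- The expectation `B_{k+1} → B_k` transported to the images in `B_N` (extended by zero). -/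
noncomputable def imageExpectation (N k : ℕ) : I.alg N → I.alg N :=
  if h : k + 1 ≤ N then Function.extend (I.towerIncl h)
    (fun x => I.towerIncl (k.le_succ.trans h) (I.expectation k x)) 0 else 0

theorem imageExpectation_towerIncl {N k : ℕ} (h : k + 1 ≤ N) (x : I.alg (k + 1)) :
    I.imageExpectation N k (I.towerIncl h x) =
      I.towerIncl (k.le_succ.trans h) (I.expectation k x) := by
  rw [imageExpectation, dif_pos h, (I.towerIncl_injective h).extend_apply]

/-- The Jones projections in `B_N` (zero outside the range `k + 2 ≤ N`). -/
noncomputable def imageProj (N k : ℕ) : I.alg N :=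
  if h : k + 2 ≤ N then I.towerIncl h (I.proj k) else 0

theorem imageProj_eq {N k : ℕ} (h : k + 2 ≤ N) :
    I.imageProj N k = I.towerIncl h (I.proj k) := dif_pos h

/-- If the index lies in `B_0`, it is a unit there. -/
theorem exists_inverse_of_index {a : I.alg 0} (ha : I.step 0 a = (I.expectation 0).index) :
    ∃ b, a * b = 1 := by
  refine ⟨I.expectation 0 (Ring.inverse (I.expectation 0).index), ?_⟩
  rw [← FaithfulCondExp.apply_incl_mul, ha, Ring.mul_inverse_cancel _ (isUnit_index _),
    ← map_one (I.step 0), FaithfulCondExp.apply_incl]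

theorem inverse_index_expectation {a b : I.alg 0} (ha : I.step 0 a = (I.expectation 0).index)
    (hab : a * b = 1) (k : ℕ) :
    Ring.inverse (I.expectation k).index = I.baseIncl (k + 1) b := by
  have h : (I.expectation k).index * I.baseIncl (k + 1) b = 1 := by
    rw [I.index_expectation ha, ← map_mul, hab, map_one]
  rw [← mul_one (Ring.inverse _), ← h, ← mul_assoc,
    Ring.inverse_mul_cancel _ (isUnit_index _), one_mul]

theorem baseIncl_comm {a : I.alg 0} (ha : I.step 0 a = (I.expectation 0).index) {N : ℕ}
    (hN : 1 ≤ N) (x : I.alg N) : I.baseIncl N a * x = x * I.baseIncl N a := by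
  obtain ⟨M, rfl⟩ := Nat.exists_eq_add_of_le' hN
  rw [← I.index_expectation ha]
  exact ((I.expectation M).index_comm x).symm

theorem star_baseIncl {a : I.alg 0} (ha : I.step 0 a = (I.expectation 0).index) {N : ℕ}
    (hN : 1 ≤ N) : star (I.baseIncl N a) = I.baseIncl N a := by
  obtain ⟨M, rfl⟩ := Nat.exists_eq_add_of_le' hN
  rw [← I.index_expectation ha]
  exact (I.expectation M).star_index

/-- The tower up to `B_N`, inside `B_N`, for an index in `B_0`. -/
noncomputable def jonesTower {a b : I.alg 0} (ha : I.step 0 a = (I.expectation 0).index)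
    (hab : a * b = 1) {N : ℕ} (hN : 1 ≤ N) : JonesTower (I.alg N) N where
  S := I.image N
  mono {j k} hjk hk d hd := by
    obtain ⟨x, rfl⟩ := (I.mem_image (hjk.trans hk)).mp hd
    rw [← I.towerIncl_towerIncl hjk hk]
    exact I.towerIncl_mem_image hk _
  e := I.imageProj N
  ex := I.imageExpectation N
  lam := I.baseIncl N b
  ind := I.baseIncl N a
  ind_mem := by
    rw [baseIncl_eq]
    exact I.towerIncl_mem_image N.zero_le a
  lam_comm x := by
    have h : I.baseIncl N b * I.baseIncl N a = 1 := by
      rw [← I.baseIncl_comm ha hN, ← map_mul, hab, map_one]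
    rw [← one_mul (x * _), ← h, mul_assoc, ← mul_assoc _ x, I.baseIncl_comm ha hN, mul_assoc x,
      ← map_mul, hab, map_one, mul_one]
  ind_comm := I.baseIncl_comm ha hN
  star_ind := I.star_baseIncl ha hN
  ind_mul_lam := by rw [← map_mul, hab, map_one]
  star_e {k} hk := by rw [I.imageProj_eq hk, ← map_star, star_proj]
  e_mem {k} hk := by
    rw [I.imageProj_eq hk]
    exact I.towerIncl_mem_image hk _
  e_mul_e {k} hk := by rw [I.imageProj_eq hk, ← map_mul, proj_mul_proj]
  e_comm {k d} hk hd := by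
    obtain ⟨x, rfl⟩ := (I.mem_image ((Nat.le_add_right k 2).trans hk)).mp hd
    rw [I.imageProj_eq hk, ← I.towerIncl_step ((Nat.le_succ _).trans hk), ← I.towerIncl_step hk,
      ← map_mul, ← map_mul, proj_mul_step_step]
  ex_mem {k d} hk hd := by
    obtain ⟨x, rfl⟩ := (I.mem_image ((Nat.le_succ _).trans hk)).mp hd
    rw [imageExpectation_towerIncl]
    exact I.towerIncl_mem_image _ _
  e_mul_mul_e {k d} hk hd := by
    obtain ⟨x, rfl⟩ := (I.mem_image ((Nat.le_succ _).trans hk)).mp hd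
    rw [imageExpectation_towerIncl, I.imageProj_eq hk,
      ← I.towerIncl_step ((Nat.le_succ _).trans hk), ← I.towerIncl_step hk, ← I.towerIncl_step hk,
      ← map_mul, ← map_mul, ← map_mul, proj_mul_step_mul_proj]
  eq_sum {k d} hk hd := by
    obtain ⟨y, rfl⟩ := (I.mem_image hk).mp hd
    obtain ⟨m, s, t, h⟩ := I.exists_eq_sum_proj k y
    have hk1 := (Nat.le_succ _).trans hk
    refine ⟨m, fun i => I.towerIncl hk1 (s i), fun i => I.towerIncl hk1 (t i),
      fun i => I.towerIncl_mem_image _ _, fun i => I.towerIncl_mem_image _ _, ?_⟩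
    rw [h, map_sum]
    refine Finset.sum_congr rfl fun i _ => ?_
    rw [I.imageProj_eq hk, map_mul, map_mul, I.towerIncl_step hk, I.towerIncl_step hk]
  cancel {k d} hk hd h := by
    obtain ⟨x, rfl⟩ := (I.mem_image ((Nat.le_succ _).trans hk)).mp hd
    rw [I.imageProj_eq hk, ← I.towerIncl_step hk, ← map_mul,
      map_eq_zero_iff _ (I.towerIncl_injective hk)] at h
    rw [I.eq_zero_of_step_mul_proj k h, map_zero]
  e_e_e {k} hk := by
    have hk1 : k + 2 ≤ N := (Nat.le_succ _).trans hk
    rw [I.imageProj_eq (k := k + 1) hk, I.imageProj_eq hk1, ← I.towerIncl_step hk, ← map_mul,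
      ← map_mul, proj_mul_step_mul_proj, expectation_proj, I.inverse_index_expectation ha hab,
      ← baseIncl_succ_apply, ← baseIncl_succ_apply, map_mul, towerIncl_baseIncl]

theorem exBase_jonesTower {a b : I.alg 0} (ha : I.step 0 a = (I.expectation 0).index)
    (hab : a * b = 1) {N : ℕ} (hN : 1 ≤ N) {n : ℕ} (h : n ≤ N) (x : I.alg n) :
    (I.jonesTower ha hab hN).exBase n (I.towerIncl h x) =
      I.baseIncl N (I.baseExpectation n x) := by
  induction n with
  | zero => exact (DFunLike.congr_fun (I.baseIncl_eq N) x).symm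
  | succ n ih =>
    refine (congrArg _ (I.imageExpectation_towerIncl h x)).trans ?_
    exact ih _ _

/-- For `N = 2 * n` the projection constructed in the tower inside `B_N` is a Jones projection for
`E_1 ∘ ⋯ ∘ E_n : B_n → A`. -/
theorem exists_isJonesProj {a b : I.alg 0} (ha : I.step 0 a = (I.expectation 0).index)
    (hab : a * b = 1) {n : ℕ} (h1 : 1 ≤ 2 * n) (h : n ≤ 2 * n) :
    ∃ f, (I.baseExpectation n).IsJonesProj (I.towerIncl h) f := by
  obtain ⟨f, hf⟩ := (I.jonesTower ha hab h1).exists_isIterated (n := n) le_rfl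
  have top : ∀ c : I.alg (2 * n), c ∈ (I.jonesTower ha hab h1).S (2 * n) := fun c => by
    have := I.towerIncl_mem_image (le_refl (2 * n)) c
    rwa [towerIncl_self] at this
  have base : ∀ c, I.baseIncl (2 * n) c ∈ (I.jonesTower ha hab h1).S 0 := fun c => by
    rw [baseIncl_eq]
    exact I.towerIncl_mem_image _ c
  refine ⟨f, hf.star_eq, hf.mul_self, fun x => ?_, fun c hc => ?_, fun c => ?_, fun c hc => ?_⟩
  · rw [hf.implements _ (I.towerIncl_mem_image h x), exBase_jonesTower, towerIncl_baseIncl]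
  · rw [towerIncl_baseIncl] at hc
    have := hf.cancel _ (base c) hc
    rw [baseIncl_eq] at this
    exact (map_eq_zero_iff _ (I.towerIncl_injective _)).mp this
  · obtain ⟨x, hx, hcx⟩ := hf.reduce c (top c)
    obtain ⟨y, rfl⟩ := (I.mem_image h).mp hx
    exact ⟨y, hcx⟩
  · exact hf.faithful c fun x _ => hc x

end FiniteIndexInclusion

end CStarIndex

theorem mainTheorem11 {A B : Type u} [CStarAlgebra A] [CStarAlgebra B] (ι : A →⋆ₐ[ℂ] B)
    (E : FaithfulCondExp ι) [E.IsIndexFinite] (hE : E.index ∈ Set.range ι) (n : ℕ) (hn : 1 ≤ n) :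
    ∃ Φ : ((FiniteIndexInclusion.of E).baseExpectation n).BasicConstruction ≃⋆ₐ[ℂ]
        (FiniteIndexInclusion.of E).alg (2 * n),
      ∀ b : (FiniteIndexInclusion.of E).alg n,
        Φ (((FiniteIndexInclusion.of E).baseExpectation n).incl b) =
          (FiniteIndexInclusion.of E).towerIncl (Nat.le_mul_of_pos_left n two_pos) b := by
  obtain ⟨a, ha⟩ := hE
  have ha' : (FiniteIndexInclusion.of E).step 0 a =
      ((FiniteIndexInclusion.of E).expectation 0).index := ha
  obtain ⟨b, hab⟩ := (FiniteIndexInclusion.of E).exists_inverse_of_index ha'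
  obtain ⟨f, hf⟩ := (FiniteIndexInclusion.of E).exists_isJonesProj ha' hab
    (hn.trans (Nat.le_mul_of_pos_left n two_pos)) (Nat.le_mul_of_pos_left n two_pos)
  exact hf.exists_starAlgEquiv
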